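/- For real $s,t,x,y$ let $$K_{s,t}(x,y)=-\frac1{4\pi^2}\int_X dV\int_{-i\infty}^{i\infty}dU\,\frac{e^{-U^4/4+tU^2/2-Uy}\,e^{V^4/4-sV^2/2+Vx}}{U-V}-\frac{\mathbb I(s<t)}{\sqrt{2\pi(t-s)}}\,e^{-\frac{(x-y)^2}{2(t-s)}}$$ be the Pearcey kernel, where $X$ consists of the ingoing rays from $\pm\infty e^{i\pi/4}$ to $0$ and the outgoing rays from $0$ to $\pm\infty e^{-i\pi/4}$. For $r\ge 1$ and $y_1<\dots<y_{2r}$ put $E=\bigcup_{i=1}^r(y_{2i-1},y_{2i})$ and let $$\mathbb P^{\mathcal P}(t,E)=\det\bigl(I-K_{t,t}\chi_E\bigr)=\sum_{n\ge0}\frac{(-1)^n}{n!}\int_{E^n}\det\bigl(K_{t,t}(x_i,x_j)\bigr)_{1\le i,j\le n}\,dx_1\cdots dx_n$$ be the probability that the Pearcey process at time $t$ has no particle in $E$. Let $\partial_E=\sum_{i=1}^{2r}\partial/\partial y_i$ and $\{f,g\}_{\partial_E}=g\,\partial_Ef-f\,\partial_Eg$. Then, for every $r\ge1$, the Wronskian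 $$\Bigl\{\frac{\partial}{\partial t}\,\partial_E^2\log\mathbb P^{\mathcal P},\ \partial_E^3\log\mathbb P^{\mathcal P}\Bigr\}_{\partial_E},$$ as a function of $t$ and of $y_1<\dots<y_{2r}$, is not identically zero: there are $t\in\mathbb R$ and $y_1<\dots<y_{2r}$ such that $\mathbb P^{\mathcal P}(t,E)>0$, the function $\log\mathbb P^{\mathcal P}$ is of class $C^4$ near $(t,y_1,\dots,y_{2r})$, and the Wronskian is nonzero at this point. -/

import Mathlib

open MeasureTheory

/-- The unit vector `e^{iπ/4}`. -/
noncomputable def pearceyOmega : ℂ := Complex.exp ((Real.pi / 4 : ℝ) * Complex.I)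

/-- The contour integral `∫_X f(V) dV`, where `X` consists of the two ingoing rays from
`±∞ e^{iπ/4}` to `0` and of the two outgoing rays from `0` to `±∞ e^{-iπ/4}`. -/
noncomputable def integralX (f : ℂ → ℂ) : ℂ :=
  -(∫ ρ in Set.Ioi (0 : ℝ), f (ρ * pearceyOmega) * pearceyOmega)
    - (∫ ρ in Set.Ioi (0 : ℝ), f (ρ * -pearceyOmega) * -pearceyOmega)
    + (∫ ρ in Set.Ioi (0 : ℝ), f (ρ * (starRingEnd ℂ) pearceyOmega) * (starRingEnd ℂ) pearceyOmega)
    + (∫ ρ in Set.Ioi (0 : ℝ),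
        f (ρ * -(starRingEnd ℂ) pearceyOmega) * -(starRingEnd ℂ) pearceyOmega)

/-- The contour integral `∫_{-i∞}^{i∞} g(U) dU` along the imaginary axis. -/
noncomputable def integralIm (g : ℂ → ℂ) : ℂ :=
  ∫ u : ℝ, g (u * Complex.I) * Complex.I

/-- The integrand of the double contour integral in the Pearcey kernel. -/
noncomputable def pearceyIntegrand (s t x y : ℝ) (V U : ℂ) : ℂ :=
  Complex.exp (-(U ^ 4 / 4) + t * U ^ 2 / 2 - U * y)
    * Complex.exp (V ^ 4 / 4 - s * V ^ 2 / 2 + V * x) * (1 / (U - V))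

/-- The double contour integral
`-1/(4π²) ∫_X dV ∫_{-i∞}^{i∞} dU e^{-U⁴/4+tU²/2-Uy} e^{V⁴/4-sV²/2+Vx} / (U-V)`. -/
noncomputable def pearceyContour (s t x y : ℝ) : ℂ :=
  -(1 / (4 * (Real.pi : ℂ) ^ 2)) *
    integralX (fun V => integralIm (fun U => pearceyIntegrand s t x y V U))

/-- The (extended) Pearcey kernel `K_{s,t}(x,y)`; the double integral is a real number by
`pearceyContour_im`, so that taking the real part loses nothing. -/
noncomputable def pearceyKernel (s t x y : ℝ) : ℝ :=
  (pearceyContour s t x y).re -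
    if s < t then
      1 / Real.sqrt (2 * Real.pi * (t - s)) * Real.exp (-((x - y) ^ 2 / (2 * (t - s))))
    else 0

theorem conj_integralX (f : ℂ → ℂ) :
    (starRingEnd ℂ) (integralX f) =
      -integralX (fun V => (starRingEnd ℂ) (f ((starRingEnd ℂ) V))) := by
  simp only [integralX, map_add, map_sub, map_neg, ← integral_conj, map_mul, Complex.conj_conj,
    Complex.conj_ofReal]
  ring

theorem conj_integralIm (g : ℂ → ℂ) :
    (starRingEnd ℂ) (integralIm g) =
      -integralIm (fun U => (starRingEnd ℂ) (g ((starRingEnd ℂ) U))) := by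
  have h := integral_neg_eq_self
    (fun u : ℝ => (starRingEnd ℂ) (g (u * Complex.I)) * Complex.I) volume
  simp only [Complex.ofReal_neg, neg_mul] at h
  simp only [integralIm, ← integral_conj, map_mul, Complex.conj_I, Complex.conj_ofReal, mul_neg,
    integral_neg, h]

theorem pearceyContour_im (s t x y : ℝ) : (pearceyContour s t x y).im = 0 := by
  rw [← Complex.conj_eq_iff_im]
  simp only [pearceyContour, map_mul, conj_integralX, conj_integralIm, pearceyIntegrand,
    ← Complex.exp_conj, map_add, map_sub, map_neg, map_div₀, map_pow, Complex.conj_conj,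
    Complex.conj_ofReal, map_one, map_ofNat]
  simp only [integralX, integral_neg, neg_mul]
  ring

/-- The Fredholm determinant `det (I - K χ_E)`, as Fredholm's series
`∑ₙ (-1)ⁿ/n! ∫_{Eⁿ} det (K(xᵢ,xⱼ)) dx₁ ⋯ dxₙ`. -/
noncomputable def fredholmDet (K : ℝ → ℝ → ℝ) (E : Set ℝ) : ℝ :=
  ∑' n : ℕ, (-1 : ℝ) ^ n / (n.factorial : ℝ) *
    ∫ x in Set.univ.pi (fun _ : Fin n => E), (Matrix.of fun i j => K (x i) (x j)).det

/-- The set `E = ⋃ᵢ (y_{2i-1}, y_{2i})`, `1 ≤ i ≤ r`, with boundary points `y₁, …, y_{2r}`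
(indexed from `0` here). -/
def intervalUnion {r : ℕ} (y : Fin (2 * r) → ℝ) : Set ℝ :=
  ⋃ i : Fin r, Set.Ioo (y ⟨2 * i.val, by omega⟩) (y ⟨2 * i.val + 1, by omega⟩)

/-- The probability that the Pearcey process at time `t` has no particle in the union of
intervals with boundary points `y`: the Fredholm determinant of the Pearcey kernel `K_{t,t}`. -/
noncomputable def pearceyProb {r : ℕ} (t : ℝ) (y : Fin (2 * r) → ℝ) : ℝ :=
  fredholmDet (pearceyKernel t t) (intervalUnion y)

/-- The operator `∂_E = ∑ᵢ ∂/∂yᵢ` on functions of `t` and of the boundary points. -/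
noncomputable def boundaryDeriv {m : ℕ} (f : ℝ → (Fin m → ℝ) → ℝ) (t : ℝ) (y : Fin m → ℝ) : ℝ :=
  ∑ i, deriv (fun s => f t (Function.update y i s)) (y i)

/-- The operator `∂/∂t` on functions of `t` and of the boundary points. -/
noncomputable def timeDeriv {m : ℕ} (f : ℝ → (Fin m → ℝ) → ℝ) (t : ℝ) (y : Fin m → ℝ) : ℝ :=
  deriv (fun s => f s y) t

/-- The Wronskian `{f, g}_{∂_E} = g ∂_E f - f ∂_E g`. -/
noncomputable def boundaryWronskian {m : ℕ} (f g : ℝ → (Fin m → ℝ) → ℝ)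
    (t : ℝ) (y : Fin m → ℝ) : ℝ :=
  g t y * boundaryDeriv f t y - f t y * boundaryDeriv g t y

/-- `log ℙ` as a function of `t` and of the `2r` boundary points of `E`. -/
noncomputable def logPearcey (r : ℕ) (t : ℝ) (y : Fin (2 * r) → ℝ) : ℝ :=
  Real.log (pearceyProb t y)

/-!
For equal-time arguments the Pearcey kernel is an entire function of `(t, x, y)`, so `log ℙ` extends
analytically across coinciding endpoints, where it vanishes. For the equally spaced endpoints
`h + ε (0, 1, …, 2r - 1)` this gives `log ℙ = -ε r ρ(t, h) + O(ε²)` with the density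
`ρ(t, h) = K_{t,t}(h, h)`, together with all derivatives in `t` and `h`, and `∂_E` acts as `∂_h`.
The Wronskian is therefore
`ε² r² (∂_h³ ρ · ∂_h ∂_t ∂_h² ρ - ∂_t ∂_h² ρ · ∂_h⁴ ρ) + O(ε³)`.
At `t = h = 0` every derivative brings down a polynomial in `U` and `V` divisible by `U - V`, which
cancels the denominator of the kernel and leaves products of one-dimensional Gamma-type integrals.
In terms of the moment `M` of `V U²`, the only one that the symmetries of the contours let survive,
`∂_h³ ρ = 0`, `∂_h⁴ ρ = -3 M` and `∂_t ∂_h² ρ = -M / 2`, and `M > 0`.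
-/

open scoped ContDiff

section ExponentialIntegral

theorem norm_normedSpaceExp_le {𝔸 : Type*} [NormedRing 𝔸] [NormedAlgebra ℝ 𝔸] [NormOneClass 𝔸]
    (b : 𝔸) : ‖NormedSpace.exp b‖ ≤ Real.exp ‖b‖ := by
  have h : HasSum (fun n : ℕ => ‖b‖ ^ n / (n.factorial : ℝ)) (Real.exp ‖b‖) := by
    rw [Real.exp_eq_exp_ℝ]
    exact NormedSpace.expSeries_div_hasSum_exp ‖b‖
  rw [congrFun (NormedSpace.exp_eq_tsum ℝ) b]
  refine tsum_of_norm_bounded h fun n => ?_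
  rw [norm_smul, norm_inv, Real.norm_natCast, div_eq_inv_mul]
  gcongr
  exact norm_pow_le b n

variable {E 𝔸 : Type*} [NormedAddCommGroup E] [NormedSpace ℝ E]
  [NormedCommRing 𝔸] [NormedAlgebra ℝ 𝔸]

/-- The homogeneous term `v ↦ b L(v₁) ⋯ L(vₙ) / n!` of the power series of `z ↦ b exp(L z)`. -/
noncomputable def expTerm (b : 𝔸) (L : E →L[ℝ] 𝔸) (n : ℕ) :
    ContinuousMultilinearMap ℝ (fun _ : Fin n => E) 𝔸 :=
  (ContinuousLinearMap.mul ℝ 𝔸 b).compContinuousMultilinearMap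
    ((NormedSpace.expSeries ℝ 𝔸 n).compContinuousLinearMap fun _ => L)

theorem expTerm_apply (b : 𝔸) (L : E →L[ℝ] 𝔸) (n : ℕ) (v : Fin n → E) :
    expTerm b L n v = (n.factorial : ℝ)⁻¹ • (b * ∏ i, L (v i)) := by
  simp [expTerm, NormedSpace.expSeries, List.prod_ofFn]

theorem continuous_expTerm (n : ℕ) :
    Continuous fun p : 𝔸 × (E →L[ℝ] 𝔸) => expTerm p.1 p.2 n := by
  have hcomp := (ContinuousLinearMap.compContinuousMultilinearMapL ℝ
    (fun _ : Fin n => E) 𝔸 𝔸).continuous₂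
  refine hcomp.comp (f := fun p : 𝔸 × (E →L[ℝ] 𝔸) => (ContinuousLinearMap.mul ℝ 𝔸 p.1,
    ContinuousMultilinearMap.compContinuousLinearMapLRight (NormedSpace.expSeries ℝ 𝔸 n)
      fun _ => p.2)) ?_
  fun_prop

theorem norm_expTerm_le [NormOneClass 𝔸] (b : 𝔸) (L : E →L[ℝ] 𝔸) (n : ℕ) :
    ‖expTerm b L n‖ ≤ ‖b‖ * (‖L‖ ^ n / n.factorial) := by
  refine ContinuousMultilinearMap.opNorm_le_bound (by positivity) fun v => ?_
  rw [expTerm_apply, norm_smul, norm_inv, Real.norm_natCast]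
  calc (n.factorial : ℝ)⁻¹ * ‖b * ∏ i, L (v i)‖
      ≤ (n.factorial : ℝ)⁻¹ * (‖b‖ * ∏ i : Fin n, (‖L‖ * ‖v i‖)) := by
        gcongr
        refine (norm_mul_le _ _).trans ?_
        gcongr
        refine (Finset.norm_prod_le _ _).trans ?_
        gcongr
        exact L.le_opNorm _
    _ = ‖b‖ * (‖L‖ ^ n / n.factorial) * ∏ i, ‖v i‖ := by
        rw [Finset.prod_mul_distrib, Finset.prod_const, Finset.card_univ, Fintype.card_fin]
        ring

theorem norm_expTerm_mul_pow_le [NormOneClass 𝔸] (b : 𝔸) (L : E →L[ℝ] 𝔸) (n : ℕ) {R : ℝ}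
    (hR : 0 ≤ R) : ‖expTerm b L n‖ * R ^ n ≤ ‖b‖ * Real.exp (R * ‖L‖) := by
  calc ‖expTerm b L n‖ * R ^ n ≤ ‖b‖ * (‖L‖ ^ n / n.factorial) * R ^ n := by
        gcongr
        exact norm_expTerm_le b L n
    _ = ‖b‖ * ((R * ‖L‖) ^ n / n.factorial) := by ring
    _ ≤ ‖b‖ * Real.exp (R * ‖L‖) := by
        gcongr
        exact Real.pow_div_factorial_le_exp _ (by positivity) n

theorem hasSum_expTerm [CompleteSpace 𝔸] (b : 𝔸) (L : E →L[ℝ] 𝔸) (z : E) :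
    HasSum (fun n => expTerm b L n fun _ => z) (b * NormedSpace.exp (L z)) :=
  (NormedSpace.expSeries_hasSum_exp (𝕂 := ℝ) (L z)).mul_left b

variable {α : Type*} [MeasurableSpace α] {μ : Measure α} {l : α → E →L[ℝ] 𝔸} {W : α → 𝔸}

/-- The function `z ↦ ∫ W(a) exp(l_a(z)) dμ(a)`, a Laplace transform with values in the
algebra `𝔸`. -/
noncomputable def expIntegral (μ : Measure α) (l : α → E →L[ℝ] 𝔸) (W : α → 𝔸) (z : E) : 𝔸 :=
  ∫ a, W a * NormedSpace.exp (l a z) ∂μ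

/-- The weight `W` has moments of all exponential orders with respect to the norm of the exponent
`l`, so that `expIntegral μ l W` is an entire function. -/
structure ExpIntegrable (μ : Measure α) (l : α → E →L[ℝ] 𝔸) (W : α → 𝔸) : Prop where
  aestronglyMeasurable_weight : AEStronglyMeasurable W μ
  aestronglyMeasurable_exponent : AEStronglyMeasurable l μ
  integrable_norm_mul_exp : ∀ R : ℝ, Integrable (fun a => ‖W a‖ * Real.exp (R * ‖l a‖)) μ

/-- The power series of `expIntegral μ l W` at the origin. -/
noncomputable def expIntegralSeries (μ : Measure α) (l : α → E →L[ℝ] 𝔸) (W : α → 𝔸) :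
    FormalMultilinearSeries ℝ E 𝔸 := fun n => ∫ a, expTerm (W a) (l a) n ∂μ

namespace ExpIntegrable

theorem aestronglyMeasurable_expTerm (h : ExpIntegrable μ l W) (n : ℕ) :
    AEStronglyMeasurable (fun a => expTerm (W a) (l a) n) μ :=
  (continuous_expTerm n).comp_aestronglyMeasurable
    (h.aestronglyMeasurable_weight.prodMk h.aestronglyMeasurable_exponent)

variable [NormOneClass 𝔸]

theorem integrable_expTerm (h : ExpIntegrable μ l W) (n : ℕ) :
    Integrable (fun a => expTerm (W a) (l a) n) μ :=
  (h.integrable_norm_mul_exp 1).mono' (h.aestronglyMeasurable_expTerm n)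
    (.of_forall fun a => by simpa using norm_expTerm_mul_pow_le (W a) (l a) n zero_le_one)

theorem radius_expIntegralSeries (h : ExpIntegrable μ l W) :
    (expIntegralSeries μ l W).radius = ⊤ := by
  refine ENNReal.eq_top_of_forall_nnreal_le fun R =>
    FormalMultilinearSeries.le_radius_of_bound _
      (∫ a, ‖W a‖ * Real.exp (R * ‖l a‖) ∂μ) fun n => ?_
  calc ‖∫ a, expTerm (W a) (l a) n ∂μ‖ * (R : ℝ) ^ n
      ≤ (∫ a, ‖expTerm (W a) (l a) n‖ ∂μ) * (R : ℝ) ^ n := by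
        gcongr
        exact norm_integral_le_integral_norm _
    _ = ∫ a, ‖expTerm (W a) (l a) n‖ * (R : ℝ) ^ n ∂μ := (integral_mul_const _ _).symm
    _ ≤ ∫ a, ‖W a‖ * Real.exp (R * ‖l a‖) ∂μ :=
        integral_mono ((h.integrable_expTerm n).norm.mul_const _) (h.integrable_norm_mul_exp R)
          fun a => norm_expTerm_mul_pow_le (W a) (l a) n R.2

variable [CompleteSpace 𝔸]

theorem integrable_mul_exp (h : ExpIntegrable μ l W) (z : E) :
    Integrable (fun a => W a * NormedSpace.exp (l a z)) μ := by
  let _ : NormedAlgebra ℚ 𝔸 := NormedAlgebra.restrictScalars ℚ ℝ 𝔸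
  refine (h.integrable_norm_mul_exp ‖z‖).mono' (h.aestronglyMeasurable_weight.mul
    (NormedSpace.exp_continuous.comp_aestronglyMeasurable
      (h.aestronglyMeasurable_exponent.apply_continuousLinearMap z))) ?_
  filter_upwards with a
  refine (norm_mul_le _ _).trans ?_
  gcongr
  refine (norm_normedSpaceExp_le _).trans (Real.exp_le_exp.2 ?_)
  rw [mul_comm]
  exact (l a).le_opNorm z

theorem hasSum_expIntegralSeries (h : ExpIntegrable μ l W) (z : E) :
    HasSum (fun n => expIntegralSeries μ l W n fun _ => z) (expIntegral μ l W z) := by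
  have hbound (a : α) : HasSum (fun n : ℕ => ‖W a‖ * ((‖z‖ * ‖l a‖) ^ n / n.factorial))
      (‖W a‖ * Real.exp (‖z‖ * ‖l a‖)) := by
    rw [Real.exp_eq_exp_ℝ]
    exact (NormedSpace.expSeries_div_hasSum_exp (‖z‖ * ‖l a‖)).mul_left _
  simp only [expIntegralSeries,
    ContinuousMultilinearMap.integral_apply (h.integrable_expTerm _)]
  refine hasSum_integral_of_dominated_convergence
    (fun n a => ‖W a‖ * ((‖z‖ * ‖l a‖) ^ n / n.factorial))
    (fun n => ?_) (fun n => .of_forall fun a => ?_) (.of_forall fun a => (hbound a).summable) ?_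
    (.of_forall fun a => hasSum_expTerm (W a) (l a) z)
  · exact (ContinuousMultilinearMap.apply ℝ _ _ _).continuous.comp_aestronglyMeasurable
      (h.aestronglyMeasurable_expTerm n)
  · refine ((expTerm (W a) (l a) n).le_of_opNorm_le (norm_expTerm_le _ _ n) _).trans (le_of_eq ?_)
    rw [Finset.prod_const, Finset.card_univ, Fintype.card_fin]
    ring
  · simpa only [(hbound _).tsum_eq] using h.integrable_norm_mul_exp ‖z‖

theorem hasFPowerSeriesOnBall (h : ExpIntegrable μ l W) :
    HasFPowerSeriesOnBall (expIntegral μ l W) (expIntegralSeries μ l W) 0 ⊤ where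
  r_le := h.radius_expIntegralSeries.ge
  r_pos := ENNReal.zero_lt_top
  hasSum {z} _ := by simpa only [zero_add] using h.hasSum_expIntegralSeries z

theorem contDiff (h : ExpIntegrable μ l W) : ContDiff ℝ ω (expIntegral μ l W) :=
  contDiff_iff_contDiffAt.2 fun _ =>
    (h.hasFPowerSeriesOnBall.analyticAt_of_mem (by simp)).contDiffAt

theorem iteratedFDeriv_zero_apply (h : ExpIntegrable μ l W) {n : ℕ} (v : Fin n → E) :
    iteratedFDeriv ℝ n (expIntegral μ l W) 0 v = ∫ a, W a * ∏ i, l a (v i) ∂μ := by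
  have hterm (σ : Equiv.Perm (Fin n)) : (expIntegralSeries μ l W n fun i => v (σ i)) =
      (n.factorial : ℝ)⁻¹ • ∫ a, W a * ∏ i, l a (v i) ∂μ := by
    rw [expIntegralSeries, ContinuousMultilinearMap.integral_apply (h.integrable_expTerm n),
      ← integral_smul]
    refine integral_congr_ae (.of_forall fun a => ?_)
    simp only [expTerm_apply, Equiv.prod_comp σ fun i => l a (v i)]
  rw [h.hasFPowerSeriesOnBall.iteratedFDeriv_eq_sum_of_completeSpace]
  simp only [hterm, Finset.sum_const, Finset.card_univ, Fintype.card_perm, Fintype.card_fin,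
    ← Nat.cast_smul_eq_nsmul ℝ]
  rw [smul_inv_smul₀ (by positivity)]

end ExpIntegrable

end ExponentialIntegral

section FredholmDeterminant

variable {𝕜 X : Type*} [RCLike 𝕜] [TopologicalSpace X] [CompactSpace X] [MeasurableSpace X]

/-- The form `f ↦ ∫ f dν` on the continuous functions on a compact space. -/
noncomputable def integralLinearMap (𝕜 : Type*) [RCLike 𝕜] [OpensMeasurableSpace X]
    (ν : Measure X) [IsFiniteMeasure ν] : C(X, 𝕜) →ₗ[𝕜] 𝕜 where
  toFun f := ∫ x, f x ∂ν
  map_add' f g :=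
    integral_add (f.continuous.integrable_of_hasCompactSupport (.of_compactSpace f))
      (g.continuous.integrable_of_hasCompactSupport (.of_compactSpace g))
  map_smul' c f := integral_const_mul c f

variable [SecondCountableTopology X] [BorelSpace X] (ν : Measure X) [IsFiniteMeasure ν]

/-- The polarization `(k₁, …, kₙ) ↦ ∑_σ sign σ ∫ ∏ᵢ kᵢ(x_{σ i}, xᵢ) dν(x₁) ⋯ dν(xₙ)` of
`k ↦ ∫ det (k(xᵢ, xⱼ)) dν(x₁) ⋯ dν(xₙ)`. -/
noncomputable def detIntegralMultilinear (𝕜 : Type*) [RCLike 𝕜] (n : ℕ) :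
    MultilinearMap 𝕜 (fun _ : Fin n => C(X × X, 𝕜)) 𝕜 :=
  ∑ σ : Equiv.Perm (Fin n), ((Equiv.Perm.sign σ : ℤ) : 𝕜) •
    (integralLinearMap 𝕜 (Measure.pi fun _ : Fin n => ν)).compMultilinearMap
      ((MultilinearMap.mkPiAlgebra 𝕜 (Fin n) C(Fin n → X, 𝕜)).compLinearMap fun i =>
        (ContinuousMap.compRightAlgHom 𝕜 𝕜
          (⟨fun x => (x (σ i), x i), by fun_prop⟩ : C(Fin n → X, X × X))).toLinearMap)

theorem detIntegralMultilinear_apply (n : ℕ) (k : Fin n → C(X × X, 𝕜)) :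
    detIntegralMultilinear ν 𝕜 n k = ∑ σ : Equiv.Perm (Fin n), ((Equiv.Perm.sign σ : ℤ) : 𝕜) *
      ∫ x, ∏ i, k i (x (σ i), x i) ∂(Measure.pi fun _ : Fin n => ν) := by
  simp [detIntegralMultilinear, integralLinearMap]

theorem norm_detIntegralMultilinear_le (n : ℕ) (k : Fin n → C(X × X, 𝕜)) :
    ‖detIntegralMultilinear ν 𝕜 n k‖ ≤ (n.factorial * ν.real Set.univ ^ n) * ∏ i, ‖k i‖ := by
  have hterm (σ : Equiv.Perm (Fin n)) : ‖((Equiv.Perm.sign σ : ℤ) : 𝕜) *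
      ∫ x, ∏ i, k i (x (σ i), x i) ∂(Measure.pi fun _ : Fin n => ν)‖ ≤
        ν.real Set.univ ^ n * ∏ i, ‖k i‖ := by
    have hsign : ‖((Equiv.Perm.sign σ : ℤ) : 𝕜)‖ = 1 := by
      rcases Int.units_eq_one_or (Equiv.Perm.sign σ) with h | h <;> simp [h]
    rw [norm_mul, hsign, one_mul, mul_comm]
    refine (norm_integral_le_of_norm_le_const (.of_forall fun x => ?_)).trans_eq
      (congrArg (_ * ·) ?_)
    · rw [norm_prod]
      gcongr
      exact (k _).norm_coe_le_norm _
    · simp [Measure.real, Measure.pi_univ]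
  rw [detIntegralMultilinear_apply]
  refine (norm_sum_le_of_le _ fun σ _ => hterm σ).trans_eq ?_
  rw [Finset.sum_const, Finset.card_univ, Fintype.card_perm, Fintype.card_fin, nsmul_eq_mul]
  ring

/-- The power series of `k ↦ det (1 - k)` on the space of continuous kernels. -/
noncomputable def fredholmSeries (𝕜 : Type*) [RCLike 𝕜] :
    FormalMultilinearSeries 𝕜 C(X × X, 𝕜) 𝕜 := fun n =>
  ((-1 : 𝕜) ^ n / (n.factorial : 𝕜)) •
    (detIntegralMultilinear ν 𝕜 n).mkContinuous _ (norm_detIntegralMultilinear_le ν n)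

theorem fredholmSeries_apply (n : ℕ) (k : C(X × X, 𝕜)) :
    fredholmSeries ν 𝕜 n (fun _ => k) = (-1 : 𝕜) ^ n / (n.factorial : 𝕜) *
      ∫ x, (Matrix.of fun i j => k (x i, x j)).det ∂(Measure.pi fun _ : Fin n => ν) := by
  simp only [fredholmSeries, smul_apply, MultilinearMap.coe_mkContinuous,
    detIntegralMultilinear_apply, smul_eq_mul, Matrix.det_apply', Matrix.of_apply]
  rw [integral_finsetSum]
  · simp_rw [integral_const_mul]
  · intro σ _
    exact (Continuous.integrable_of_hasCompactSupport (by fun_prop)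
      (.of_compactSpace _)).const_mul _

theorem norm_fredholmSeries_le (n : ℕ) : ‖fredholmSeries ν 𝕜 n‖ ≤ ν.real Set.univ ^ n := by
  refine ContinuousMultilinearMap.opNorm_le_bound (by positivity) fun k => ?_
  have happly : fredholmSeries ν 𝕜 n k =
      (-1 : 𝕜) ^ n / (n.factorial : 𝕜) * detIntegralMultilinear ν 𝕜 n k := rfl
  rw [happly, norm_mul, norm_div, norm_pow, norm_neg, norm_one, one_pow, RCLike.norm_natCast]
  calc 1 / (n.factorial : ℝ) * ‖detIntegralMultilinear ν 𝕜 n k‖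
      ≤ 1 / (n.factorial : ℝ) * ((n.factorial * ν.real Set.univ ^ n) * ∏ i, ‖k i‖) := by
        gcongr
        exact norm_detIntegralMultilinear_le ν n k
    _ = ν.real Set.univ ^ n * ∏ i, ‖k i‖ := by field_simp

theorem fredholmSeries_radius_pos : 0 < (fredholmSeries ν 𝕜).radius := by
  have hR : 0 < (ν.real Set.univ + 1)⁻¹ := by positivity
  let R : NNReal := ⟨(ν.real Set.univ + 1)⁻¹, hR.le⟩
  refine lt_of_lt_of_le (ENNReal.coe_pos.2 (NNReal.coe_pos.1 hR : 0 < R))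
    ((fredholmSeries ν 𝕜).le_radius_of_bound 1 fun n => ?_)
  calc ‖fredholmSeries ν 𝕜 n‖ * (R : ℝ) ^ n
      ≤ ν.real Set.univ ^ n * (ν.real Set.univ + 1)⁻¹ ^ n := by
        gcongr
        exacts [norm_fredholmSeries_le ν n, le_rfl]
    _ = (ν.real Set.univ * (ν.real Set.univ + 1)⁻¹) ^ n := (mul_pow _ _ _).symm
    _ ≤ 1 := pow_le_one₀ (by positivity) (by rw [mul_inv_le_iff₀ (by positivity)]; linarith)

/-- The Fredholm determinant `det (1 - k)` of a continuous kernel `k` on a compact space. -/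
noncomputable def kernelFredholmDet (k : C(X × X, 𝕜)) : 𝕜 :=
  ∑' n : ℕ, (-1 : 𝕜) ^ n / (n.factorial : 𝕜) *
    ∫ x, (Matrix.of fun i j => k (x i, x j)).det ∂(Measure.pi fun _ : Fin n => ν)

theorem hasFPowerSeriesOnBall_kernelFredholmDet :
    HasFPowerSeriesOnBall (kernelFredholmDet ν) (fredholmSeries ν 𝕜) 0
      (fredholmSeries ν 𝕜).radius := by
  have hsum : kernelFredholmDet ν = (fredholmSeries ν 𝕜).sum := by
    funext k
    simp only [kernelFredholmDet, FormalMultilinearSeries.sum, fredholmSeries_apply]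
  exact hsum ▸ (fredholmSeries ν 𝕜).hasFPowerSeriesOnBall (fredholmSeries_radius_pos ν)

theorem contDiffAt_kernelFredholmDet_zero : ContDiffAt 𝕜 ω (kernelFredholmDet (𝕜 := 𝕜) ν) 0 :=
  (hasFPowerSeriesOnBall_kernelFredholmDet ν).analyticAt.contDiffAt

theorem kernelFredholmDet_zero : kernelFredholmDet ν (0 : C(X × X, 𝕜)) = 1 := by
  rw [← (hasFPowerSeriesOnBall_kernelFredholmDet ν).coeff_zero fun _ => 0, fredholmSeries_apply]
  simp [Measure.real]

theorem fderiv_kernelFredholmDet_zero (k : C(X × X, 𝕜)) :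
    fderiv 𝕜 (kernelFredholmDet ν) 0 k = -∫ x, k (x, x) ∂ν := by
  have hconst : (Fin.snoc 0 k : Fin 1 → C(X × X, 𝕜)) = fun _ => k := by
    funext i
    fin_cases i
    simp [Fin.snoc]
  have hunique := (measurePreserving_funUnique ν (Fin 1)).integral_comp
    (MeasurableEquiv.measurableEmbedding _) fun x => k (x, x)
  rw [(hasFPowerSeriesOnBall_kernelFredholmDet ν).hasFPowerSeriesAt.hasFDerivAt.fderiv,
    continuousMultilinearCurryFin1_apply, hconst, fredholmSeries_apply, ← hunique]
  simp [MeasurableEquiv.funUnique, Matrix.det_unique]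
  rfl

end FredholmDeterminant

section DoubleContour

theorem pearceyOmega_sq : pearceyOmega ^ 2 = Complex.I := by
  rw [pearceyOmega, ← Complex.exp_nat_mul]
  refine Eq.trans ?_ Complex.exp_pi_div_two_mul_I
  congr 1
  push_cast
  ring

theorem conj_pearceyOmega_sq : (starRingEnd ℂ) pearceyOmega ^ 2 = -Complex.I := by
  rw [← map_pow, pearceyOmega_sq, Complex.conj_I]

theorem pearceyOmega_re : pearceyOmega.re = √2 / 2 := by
  rw [pearceyOmega, Complex.exp_ofReal_mul_I_re, Real.cos_pi_div_four]

theorem pearceyOmega_im : pearceyOmega.im = √2 / 2 := by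
  rw [pearceyOmega, Complex.exp_ofReal_mul_I_im, Real.sin_pi_div_four]

/-- The directions of the four rays of the contour `X`. -/
noncomputable def rayDir : Fin 4 → ℂ :=
  ![pearceyOmega, -pearceyOmega, (starRingEnd ℂ) pearceyOmega, -(starRingEnd ℂ) pearceyOmega]

/-- The orientations of the four rays of the contour `X`: `-1` for ingoing, `1` for outgoing. -/
noncomputable def raySign : Fin 4 → ℂ := ![-1, -1, 1, 1]

theorem norm_raySign (i : Fin 4) : ‖raySign i‖ = 1 := by
  fin_cases i <;> simp [raySign]

theorem rayDir_pow_four (i : Fin 4) : rayDir i ^ 4 = -1 := by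
  rw [show rayDir i ^ 4 = (rayDir i ^ 2) ^ 2 by ring]
  fin_cases i <;> simp [rayDir, pearceyOmega_sq, conj_pearceyOmega_sq]

theorem norm_rayDir (i : Fin 4) : ‖rayDir i‖ = 1 := by
  have h : ‖rayDir i‖ ^ 4 = 1 := by rw [← norm_pow, rayDir_pow_four, norm_neg, norm_one]
  exact (pow_eq_one_iff_of_nonneg (norm_nonneg _) (by norm_num)).1 h

theorem rayDir_re_sq (i : Fin 4) : (rayDir i).re ^ 2 = 1 / 2 := by
  have h : (√2 / 2) ^ 2 = (2 : ℝ)⁻¹ := by rw [div_pow, Real.sq_sqrt (by norm_num)]; norm_num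
  fin_cases i <;> simp [rayDir, pearceyOmega_re, h]

theorem rayDir_im_sq (i : Fin 4) : (rayDir i).im ^ 2 = 1 / 2 := by
  have h : (√2 / 2) ^ 2 = (2 : ℝ)⁻¹ := by rw [div_pow, Real.sq_sqrt (by norm_num)]; norm_num
  fin_cases i <;> simp [rayDir, pearceyOmega_im, h]

/-- The parameters `(i, ρ, u)` of the points `(V, U) = (ρ ωᵢ, iu)` of the double contour, `ωᵢ` being
the direction of the `i`-th ray of `X`; the values `ρ ≤ 0` are null for `contourMeasure`. -/
abbrev ContourParam := Fin 4 × ℝ × ℝ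

/-- The measure `dρ du` on the parameters of the double contour, for `ρ > 0`. -/
noncomputable def contourMeasure : Measure ContourParam :=
  Measure.count.prod ((volume.restrict (Set.Ioi 0)).prod volume)

/-- The point `V` of the contour `X`. -/
noncomputable def pointV (p : ContourParam) : ℂ := p.2.1 * rayDir p.1

/-- The point `U` of the imaginary axis. -/
noncomputable def pointU (p : ContourParam) : ℂ := p.2.2 * Complex.I

/-- The weight of the double contour integral at `s = t = x = y = 0`, without `1 / (U - V)`. -/
noncomputable def baseWeight (p : ContourParam) : ℂ :=
  -(1 / (4 * (Real.pi : ℂ) ^ 2)) * raySign p.1 * rayDir p.1 * Complex.I *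
    Complex.exp (-(pointU p ^ 4 / 4)) * Complex.exp (pointV p ^ 4 / 4)

/-- The weight of the double contour integral at `s = t = x = y = 0`. -/
noncomputable def contourWeight (p : ContourParam) : ℂ :=
  baseWeight p * (1 / (pointU p - pointV p))

/-- A quantity that dominates `|U|`, `|V|`, `|U|²` and `|V|²`. -/
noncomputable def contourGauge (p : ContourParam) : ℝ := 1 + p.2.1 ^ 2 + p.2.2 ^ 2

theorem ae_contourMeasure : ∀ᵐ p ∂contourMeasure, 0 < p.2.1 ∧ p.2.2 ≠ 0 := by
  have h : ∀ᵐ q ∂((volume.restrict (Set.Ioi (0 : ℝ))).prod (volume : Measure ℝ)),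
      0 < q.1 ∧ q.2 ≠ 0 :=
    (Measure.quasiMeasurePreserving_fst.ae (ae_restrict_mem measurableSet_Ioi)).and
      (Measure.quasiMeasurePreserving_snd.ae (p := fun u : ℝ => u ≠ 0) (Measure.ae_ne volume 0))
  exact Measure.quasiMeasurePreserving_snd.ae h

@[fun_prop]
theorem measurable_pointV : Measurable pointV := by
  unfold pointV
  fun_prop

@[fun_prop]
theorem measurable_pointU : Measurable pointU := by
  unfold pointU
  fun_prop

@[fun_prop]
theorem measurable_baseWeight : Measurable baseWeight := by
  unfold baseWeight
  fun_prop

@[fun_prop]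
theorem measurable_contourWeight : Measurable contourWeight := by
  unfold contourWeight
  fun_prop

@[fun_prop]
theorem measurable_contourGauge : Measurable contourGauge := by
  unfold contourGauge
  fun_prop

theorem pointU_pow_four (p : ContourParam) : pointU p ^ 4 = (p.2.2 ^ 4 : ℝ) := by
  rw [pointU, mul_pow, Complex.I_pow_four, mul_one, Complex.ofReal_pow]

theorem pointV_pow_four (p : ContourParam) : pointV p ^ 4 = -(p.2.1 ^ 4 : ℝ) := by
  rw [pointV, mul_pow, rayDir_pow_four, mul_neg_one, Complex.ofReal_pow]

theorem norm_baseWeight (p : ContourParam) : ‖baseWeight p‖ =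
    1 / (4 * Real.pi ^ 2) * (Real.exp (-(p.2.1 ^ 4 / 4)) * Real.exp (-(p.2.2 ^ 4 / 4))) := by
  have hU : Complex.exp (-(pointU p ^ 4 / 4)) = Real.exp (-(p.2.2 ^ 4 / 4)) := by
    rw [pointU_pow_four]; push_cast; rfl
  have hV : Complex.exp (pointV p ^ 4 / 4) = Real.exp (-(p.2.1 ^ 4 / 4)) := by
    rw [pointV_pow_four]; push_cast; ring_nf
  simp only [baseWeight, hU, hV, norm_mul, norm_raySign, norm_rayDir, Complex.norm_real,
    Real.norm_eq_abs, Real.abs_exp, norm_neg, norm_div, norm_pow, norm_one, Complex.norm_ofNat,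
    Complex.norm_I, abs_of_pos Real.pi_pos]
  ring

theorem half_mul_abs_le_norm_sq (p : ContourParam) :
    p.2.1 * |p.2.2| / 2 ≤ ‖pointU p - pointV p‖ ^ 2 := by
  obtain ⟨i, ρ, u⟩ := p
  have hre := rayDir_re_sq i
  have him := rayDir_im_sq i
  rw [← Complex.normSq_eq_norm_sq, Complex.normSq_apply]
  simp only [pointU, pointV, Complex.sub_re, Complex.sub_im, Complex.mul_re, Complex.mul_im,
    Complex.ofReal_re, Complex.ofReal_im, Complex.I_re, Complex.I_im]
  set a := (rayDir i).re
  set b := (rayDir i).im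
  have hamgm : ρ * |u| ≤ (ρ ^ 2 + u ^ 2) / 2 := by
    nlinarith [sq_nonneg (ρ - |u|), sq_abs u]
  nlinarith [sq_nonneg (4 * b * u - 3 * ρ), sq_nonneg ρ, sq_nonneg u]

theorem pointU_ne_pointV {p : ContourParam} (hρ : 0 < p.2.1) (hu : p.2.2 ≠ 0) :
    pointU p ≠ pointV p := by
  have h := half_mul_abs_le_norm_sq p
  have hpos : 0 < p.2.1 * |p.2.2| / 2 := by positivity
  rw [← sub_ne_zero, ← norm_ne_zero_iff]
  intro h0
  rw [h0] at h
  linarith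

theorem norm_one_div_pointU_sub_pointV_le {p : ContourParam} (hρ : 0 < p.2.1) (hu : p.2.2 ≠ 0) :
    ‖1 / (pointU p - pointV p)‖ ≤ 2 * (p.2.1 ^ (-(1 / 2) : ℝ) * |p.2.2| ^ (-(1 / 2) : ℝ)) := by
  have hu' : 0 < |p.2.2| := abs_pos.2 hu
  have hsq : √(p.2.1 * |p.2.2|) ^ 2 = p.2.1 * |p.2.2| := Real.sq_sqrt (by positivity)
  have hle : √(p.2.1 * |p.2.2|) / 2 ≤ ‖pointU p - pointV p‖ :=
    (abs_le_of_sq_le_sq' (by nlinarith [half_mul_abs_le_norm_sq p]) (norm_nonneg _)).2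
  rw [← Real.mul_rpow hρ.le hu'.le, Real.rpow_neg (by positivity), ← Real.sqrt_eq_rpow, norm_div,
    norm_one]
  calc 1 / ‖pointU p - pointV p‖ ≤ 1 / (√(p.2.1 * |p.2.2|) / 2) := by gcongr
    _ = 2 * (√(p.2.1 * |p.2.2|))⁻¹ := by field_simp

theorem integrableOn_rpow_mul_exp_quartic (R : ℝ) :
    IntegrableOn (fun x : ℝ => x ^ (-(1 / 2) : ℝ) * Real.exp (-(x ^ 4 / 4) + R * x ^ 2))
      (Set.Ioi 0) := by
  have h := (Real.GammaIntegral_convergent (s := 1 / 2) (by norm_num)).const_mul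
    (Real.exp ((R + 1 / 2) ^ 2 + 1 / 2))
  refine h.mono' (by fun_prop) ?_
  filter_upwards [ae_restrict_mem measurableSet_Ioi] with x (hx : 0 < x)
  rw [Real.norm_of_nonneg (by positivity), show (1 / 2 - 1 : ℝ) = -(1 / 2) by norm_num, ← mul_assoc,
    ← Real.exp_add, mul_comm]
  refine mul_le_mul_of_nonneg_right (Real.exp_le_exp.2 ?_) (by positivity)
  nlinarith [sq_nonneg (x ^ 2 / 2 - (R + 1 / 2)), sq_nonneg (x - 1)]

theorem integrable_comp_abs_of_integrableOn {F : Type*} [NormedAddCommGroup F] {f : ℝ → F}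
    (hf : IntegrableOn f (Set.Ioi 0)) : Integrable fun x => f |x| := by
  have hpos : IntegrableOn (fun x => f |x|) (Set.Ioi 0) :=
    hf.congr_fun (fun x hx => by rw [abs_of_pos hx]) measurableSet_Ioi
  have hneg : IntegrableOn (fun x => f |x|) (Set.Iio 0) := by
    simpa only [abs_neg, Set.neg_Ioi, neg_zero] using hpos.comp_neg
  rw [← integrableOn_univ, ← Set.Iic_union_Ioi (a := (0 : ℝ))]
  exact (Iff.mpr integrableOn_Iic_iff_integrableOn_Iio hneg).union hpos

theorem integrable_norm_contourWeight_mul_exp (R : ℝ) :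
    Integrable (fun p => ‖contourWeight p‖ * Real.exp (R * contourGauge p)) contourMeasure := by
  have hρ := integrableOn_rpow_mul_exp_quartic R
  have hmajorant : Integrable (fun p : ContourParam => Real.exp R *
      ((p.2.1 ^ (-(1 / 2) : ℝ) * Real.exp (-(p.2.1 ^ 4 / 4) + R * p.2.1 ^ 2)) *
        (|p.2.2| ^ (-(1 / 2) : ℝ) * Real.exp (-(|p.2.2| ^ 4 / 4) + R * |p.2.2| ^ 2))))
      contourMeasure :=
    (integrable_const (Real.exp R)).mul_prod
      (hρ.mul_prod (integrable_comp_abs_of_integrableOn hρ))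
  refine hmajorant.mono' (by fun_prop) ?_
  filter_upwards [ae_contourMeasure] with p ⟨hρ, hu⟩
  have hpi : 1 / (4 * Real.pi ^ 2) ≤ 1 / 2 := by
    gcongr
    nlinarith [Real.pi_gt_three]
  rw [Real.norm_of_nonneg (by positivity), contourWeight, norm_mul, norm_baseWeight]
  calc 1 / (4 * Real.pi ^ 2) * (Real.exp (-(p.2.1 ^ 4 / 4)) * Real.exp (-(p.2.2 ^ 4 / 4))) *
        ‖1 / (pointU p - pointV p)‖ * Real.exp (R * contourGauge p)
      ≤ 1 / 2 * (Real.exp (-(p.2.1 ^ 4 / 4)) * Real.exp (-(p.2.2 ^ 4 / 4))) *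
        (2 * (p.2.1 ^ (-(1 / 2) : ℝ) * |p.2.2| ^ (-(1 / 2) : ℝ))) *
        Real.exp (R * contourGauge p) := by
        gcongr
        exact norm_one_div_pointU_sub_pointV_le hρ hu
    _ = _ := by
        simp only [contourGauge, mul_add, mul_one, Real.exp_add, sq_abs,
          (by decide : Even 4).pow_abs]
        ring

end DoubleContour

section KernelFormula

/-- The coefficient of `t` in the exponent of the Pearcey kernel `K_{t,t}`. -/
noncomputable def exponentT (p : ContourParam) : ℂ := (pointU p ^ 2 - pointV p ^ 2) / 2

@[fun_prop]
theorem measurable_exponentT : Measurable exponentT := by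
  unfold exponentT
  fun_prop

theorem norm_pointV (p : ContourParam) : ‖pointV p‖ = |p.2.1| := by
  rw [pointV, norm_mul, norm_rayDir, mul_one, Complex.norm_real, Real.norm_eq_abs]

theorem norm_pointU (p : ContourParam) : ‖pointU p‖ = |p.2.2| := by
  rw [pointU, norm_mul, Complex.norm_I, mul_one, Complex.norm_real, Real.norm_eq_abs]

theorem norm_pointV_le (p : ContourParam) : ‖pointV p‖ ≤ contourGauge p := by
  rw [norm_pointV, contourGauge]
  nlinarith [sq_nonneg (|p.2.1| - 1), sq_abs p.2.1, sq_nonneg p.2.1, sq_nonneg p.2.2]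

theorem norm_pointU_le (p : ContourParam) : ‖pointU p‖ ≤ contourGauge p := by
  rw [norm_pointU, contourGauge]
  nlinarith [sq_nonneg (|p.2.2| - 1), sq_abs p.2.2, sq_nonneg p.2.2, sq_nonneg p.2.1]

theorem norm_exponentT_le (p : ContourParam) : ‖exponentT p‖ ≤ contourGauge p := by
  have h := norm_sub_le (pointU p ^ 2) (pointV p ^ 2)
  rw [norm_pow, norm_pow, norm_pointU, norm_pointV, sq_abs, sq_abs] at h
  rw [exponentT, norm_div, Complex.norm_ofNat, contourGauge]
  linarith [sq_nonneg p.2.1, sq_nonneg p.2.2]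

variable {𝔸 : Type*} [NormedCommRing 𝔸] [NormedAlgebra ℂ 𝔸]

/-- The exponent `t (U² - V²) / 2 + x V - y U` of the Pearcey kernel `K_{t,t}(x,y)`, as a linear
function of `(t, x, y)` with values in a Banach algebra. -/
noncomputable def contourExponent (𝔸 : Type*) [NormedCommRing 𝔸]
    [NormedAlgebra ℂ 𝔸] (p : ContourParam) : 𝔸 × 𝔸 × 𝔸 →L[ℝ] 𝔸 :=
  exponentT p • ContinuousLinearMap.fst ℝ 𝔸 (𝔸 × 𝔸) +
    pointV p • (ContinuousLinearMap.fst ℝ 𝔸 𝔸 ∘L ContinuousLinearMap.snd ℝ 𝔸 (𝔸 × 𝔸)) -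
    pointU p • (ContinuousLinearMap.snd ℝ 𝔸 𝔸 ∘L ContinuousLinearMap.snd ℝ 𝔸 (𝔸 × 𝔸))

theorem contourExponent_apply (p : ContourParam) (z : 𝔸 × 𝔸 × 𝔸) :
    contourExponent 𝔸 p z = exponentT p • z.1 + pointV p • z.2.1 - pointU p • z.2.2 := rfl

theorem norm_contourExponent_le (p : ContourParam) :
    ‖contourExponent 𝔸 p‖ ≤ 3 * contourGauge p := by
  have hgauge : 0 ≤ contourGauge p := by rw [contourGauge]; positivity
  refine ContinuousLinearMap.opNorm_le_bound _ (by positivity) fun z => ?_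
  have hz : ‖z.2‖ ≤ ‖z‖ := norm_snd_le z
  calc ‖contourExponent 𝔸 p z‖
      ≤ ‖exponentT p • z.1‖ + ‖pointV p • z.2.1‖ + ‖pointU p • z.2.2‖ :=
        (norm_sub_le _ _).trans (add_le_add_left (norm_add_le _ _) _)
    _ ≤ contourGauge p * ‖z‖ + contourGauge p * ‖z‖ + contourGauge p * ‖z‖ := by
        simp only [norm_smul]
        gcongr
        exacts [norm_exponentT_le p, norm_fst_le z, norm_pointV_le p, (norm_fst_le z.2).trans hz,
          norm_pointU_le p, (norm_snd_le z.2).trans hz]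
    _ = 3 * contourGauge p * ‖z‖ := by ring

theorem aestronglyMeasurable_contourExponent :
    AEStronglyMeasurable (contourExponent 𝔸) contourMeasure :=
  ((measurable_exponentT.aestronglyMeasurable.smul_const _).add
    (measurable_pointV.aestronglyMeasurable.smul_const _)).sub
    (measurable_pointU.aestronglyMeasurable.smul_const _)

theorem expIntegrable_contourExponent [NormOneClass 𝔸] :
    ExpIntegrable contourMeasure (contourExponent 𝔸)
      (fun p => algebraMap ℂ 𝔸 (contourWeight p)) where
  aestronglyMeasurable_weight := (algebraMapCLM ℂ 𝔸).continuous.comp_aestronglyMeasurable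
    measurable_contourWeight.aestronglyMeasurable
  aestronglyMeasurable_exponent := aestronglyMeasurable_contourExponent
  integrable_norm_mul_exp R := by
    have hexponent := aestronglyMeasurable_contourExponent (𝔸 := 𝔸)
    simp only [norm_algebraMap']
    refine (integrable_norm_contourWeight_mul_exp (|R| * 3)).mono' (by fun_prop)
      (.of_forall fun p => ?_)
    rw [Real.norm_of_nonneg (by positivity)]
    gcongr ?_ * Real.exp ?_
    calc R * ‖contourExponent 𝔸 p‖ ≤ |R| * (3 * contourGauge p) := by
          gcongr
          exacts [le_abs_self R, norm_contourExponent_le p]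
      _ = |R| * 3 * contourGauge p := by ring

/-- The Pearcey kernel `K_{t,t}(x,y)` with arguments in a Banach algebra: over an algebra of
continuous functions it is a kernel pulled back along a parametrization. -/
noncomputable def contourTransform (z : 𝔸 × 𝔸 × 𝔸) : 𝔸 :=
  expIntegral contourMeasure (contourExponent 𝔸) (fun p => algebraMap ℂ 𝔸 (contourWeight p)) z

theorem contDiff_contourTransform [NormOneClass 𝔸] [CompleteSpace 𝔸] :
    ContDiff ℝ ω (contourTransform (𝔸 := 𝔸)) :=
  expIntegrable_contourExponent.contDiff

theorem iteratedFDeriv_contourTransform_zero [NormOneClass 𝔸] [CompleteSpace 𝔸] {n : ℕ}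
    (v : Fin n → 𝔸 × 𝔸 × 𝔸) : iteratedFDeriv ℝ n (contourTransform (𝔸 := 𝔸)) 0 v =
      ∫ p, algebraMap ℂ 𝔸 (contourWeight p) * ∏ i, contourExponent 𝔸 p (v i) ∂contourMeasure :=
  expIntegrable_contourExponent.iteratedFDeriv_zero_apply v

theorem map_contourTransform [NormOneClass 𝔸] [CompleteSpace 𝔸] (χ : 𝔸 →A[ℂ] ℂ)
    (z : 𝔸 × 𝔸 × 𝔸) : χ (contourTransform z) = contourTransform (χ z.1, χ z.2.1, χ z.2.2) := by
  have hexp (a : 𝔸) : χ (NormedSpace.exp a) = NormedSpace.exp (χ a) := by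
    let _ : NormedAlgebra ℚ 𝔸 := NormedAlgebra.restrictScalars ℚ ℝ 𝔸
    exact NormedSpace.map_exp χ χ.continuous a
  refine ((χ.toContinuousLinearMap.integral_comp_comm
    (expIntegrable_contourExponent.integrable_mul_exp z)).symm).trans
    (integral_congr_ae (.of_forall fun p => ?_))
  change χ (_ * _) = _
  rw [map_mul, hexp]
  simp only [contourExponent_apply, map_add, map_sub, map_smul, Algebra.algebraMap_self,
    RingHom.id_apply]
  congr 1
  exact χ.commutes' _

theorem contourWeight_mul_exp (t x y : ℝ) (p : ContourParam) :
    contourWeight p * Complex.exp (exponentT p * t + pointV p * x - pointU p * y) =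
      -(1 / (4 * (Real.pi : ℂ) ^ 2)) * raySign p.1 *
        (pearceyIntegrand t t x y (pointV p) (pointU p) * Complex.I * rayDir p.1) := by
  have hexp : Complex.exp (-(pointU p ^ 4 / 4)) * Complex.exp (pointV p ^ 4 / 4) *
      Complex.exp (exponentT p * t + pointV p * x - pointU p * y) =
      Complex.exp (-(pointU p ^ 4 / 4) + t * pointU p ^ 2 / 2 - pointU p * y) *
        Complex.exp (pointV p ^ 4 / 4 - t * pointV p ^ 2 / 2 + pointV p * x) := by
    simp only [← Complex.exp_add, exponentT]
    congr 1
    ring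
  rw [pearceyIntegrand, ← hexp, contourWeight, baseWeight]
  ring

theorem contourTransform_eq_pearceyContour (t x y : ℝ) :
    contourTransform ((t : ℂ), (x : ℂ), (y : ℂ)) = pearceyContour t t x y := by
  have hfun (p : ContourParam) : algebraMap ℂ ℂ (contourWeight p) *
      NormedSpace.exp (contourExponent ℂ p ((t : ℂ), (x : ℂ), (y : ℂ))) =
      -(1 / (4 * (Real.pi : ℂ) ^ 2)) * raySign p.1 *
        (pearceyIntegrand t t x y (pointV p) (pointU p) * Complex.I * rayDir p.1) := by
    rw [← contourWeight_mul_exp, Complex.exp_eq_exp_ℂ]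
    rfl
  have hint := (expIntegrable_contourExponent (𝔸 := ℂ)).integrable_mul_exp
    ((t : ℂ), (x : ℂ), (y : ℂ))
  simp only [contourTransform, expIntegral, hfun] at hint ⊢
  have hray := hint.prod_right_ae
  rw [Measure.ae_count_iff] at hray
  have hrayIntegral (i : Fin 4) : ∫ q : ℝ × ℝ, -(1 / (4 * (Real.pi : ℂ) ^ 2)) * raySign i *
      (pearceyIntegrand t t x y (pointV (i, q)) (pointU (i, q)) * Complex.I * rayDir i)
        ∂((volume.restrict (Set.Ioi 0)).prod volume) =
      -(1 / (4 * (Real.pi : ℂ) ^ 2)) * raySign i * ∫ ρ in Set.Ioi (0 : ℝ),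
        integralIm (fun U => pearceyIntegrand t t x y (ρ * rayDir i) U) * rayDir i := by
    rw [integral_prod _ (hray i), ← integral_const_mul]
    refine integral_congr_ae (.of_forall fun ρ => ?_)
    simp only [integralIm, pointV, pointU]
    rw [integral_const_mul, integral_mul_const]
  rw [contourMeasure, integral_prod _ hint, integral_count]
  simp only [hrayIntegral, Fin.sum_univ_four, pearceyContour, integralX]
  simp only [rayDir, raySign, Matrix.cons_val]
  ring

theorem pearceyKernel_self (t x y : ℝ) : pearceyKernel t t x y = (pearceyContour t t x y).re := by
  simp [pearceyKernel]

theorem continuous_pearceyKernel_self (t : ℝ) :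
    Continuous (Function.uncurry (pearceyKernel t t)) := by
  have heq : Function.uncurry (pearceyKernel t t) = fun p : ℝ × ℝ =>
      (contourTransform ((t : ℂ), (p.1 : ℂ), (p.2 : ℂ))).re := by
    funext p
    rw [Function.uncurry, pearceyKernel_self, contourTransform_eq_pearceyContour]
  have hcont := (contDiff_contourTransform (𝔸 := ℂ)).continuous
  rw [heq]
  fun_prop

end KernelFormula

section Moments

theorem pow_mul_exp_quartic_eq_rpow (j : ℕ) (x : ℝ) :
    x ^ j * Real.exp (-(x ^ 4 / 4)) = x ^ (j : ℝ) * Real.exp (-(1 / 4) * x ^ (4 : ℝ)) := by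
  rw [Real.rpow_natCast, show x ^ (4 : ℝ) = x ^ 4 from mod_cast Real.rpow_natCast x 4]
  ring_nf

theorem integrableOn_pow_mul_exp_quartic (j : ℕ) :
    IntegrableOn (fun x : ℝ => x ^ j * Real.exp (-(x ^ 4 / 4))) (Set.Ioi 0) := by
  simp only [pow_mul_exp_quartic_eq_rpow]
  exact integrableOn_rpow_mul_exp_neg_mul_rpow (by linarith [j.cast_nonneg (α := ℝ)])
    (by norm_num) (by norm_num)

theorem integrable_pow_mul_exp_quartic (j : ℕ) :
    Integrable fun x : ℝ => x ^ j * Real.exp (-(x ^ 4 / 4)) := by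
  refine (integrable_comp_abs_of_integrableOn (integrableOn_pow_mul_exp_quartic j)).mono'
    (by fun_prop) (.of_forall fun x => le_of_eq ?_)
  rw [norm_mul, norm_pow, Real.norm_eq_abs, Real.norm_eq_abs, Real.abs_exp,
    (by decide : Even 4).pow_abs]

theorem integral_pow_mul_exp_quartic_pos (j : ℕ) :
    0 < ∫ x in Set.Ioi (0 : ℝ), x ^ j * Real.exp (-(x ^ 4 / 4)) := by
  simp only [pow_mul_exp_quartic_eq_rpow]
  rw [integral_rpow_mul_exp_neg_mul_rpow (by norm_num)
    (by linarith [j.cast_nonneg (α := ℝ)]) (by norm_num)]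
  exact mul_pos (by positivity) (Real.Gamma_pos_of_pos (by positivity))

/-- The moments `∫ V^j U^k` of the double contour integral. -/
noncomputable def contourMoment (j k : ℕ) : ℂ :=
  ∫ p, baseWeight p * (pointV p ^ j * pointU p ^ k) ∂contourMeasure

theorem baseWeight_mul_pow_mul_pow (j k : ℕ) (p : ContourParam) :
    baseWeight p * (pointV p ^ j * pointU p ^ k) =
      -(1 / (4 * (Real.pi : ℂ) ^ 2)) * Complex.I ^ (k + 1) *
        (raySign p.1 * rayDir p.1 ^ (j + 1)) *
      (((p.2.1 ^ j * Real.exp (-(p.2.1 ^ 4 / 4)) : ℝ) : ℂ) *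
        ((p.2.2 ^ k * Real.exp (-(p.2.2 ^ 4 / 4)) : ℝ) : ℂ)) := by
  rw [baseWeight, pointU_pow_four, pointV_pow_four, pointU, pointV]
  push_cast
  rw [neg_div]
  ring

theorem integrable_baseWeight_mul (j k : ℕ) :
    Integrable (fun p => baseWeight p * (pointV p ^ j * pointU p ^ k)) contourMeasure := by
  simp only [baseWeight_mul_pow_mul_pow]
  exact Integrable.mul_prod (f := fun i : Fin 4 => -(1 / (4 * (Real.pi : ℂ) ^ 2)) *
      Complex.I ^ (k + 1) * (raySign i * rayDir i ^ (j + 1))) .of_finite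
    ((integrableOn_pow_mul_exp_quartic j).ofReal.mul_prod
      (integrable_pow_mul_exp_quartic k).ofReal)

theorem contourMoment_eq (j k : ℕ) : contourMoment j k =
    -(1 / (4 * (Real.pi : ℂ) ^ 2)) * Complex.I ^ (k + 1) * (∑ i, raySign i * rayDir i ^ (j + 1)) *
      ((∫ ρ in Set.Ioi (0 : ℝ), ρ ^ j * Real.exp (-(ρ ^ 4 / 4)) : ℝ) *
        (∫ u : ℝ, u ^ k * Real.exp (-(u ^ 4 / 4)) : ℝ)) := by
  simp only [contourMoment, baseWeight_mul_pow_mul_pow, contourMeasure]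
  rw [integral_prod_mul (fun i : Fin 4 => -(1 / (4 * (Real.pi : ℂ) ^ 2)) * Complex.I ^ (k + 1) *
      (raySign i * rayDir i ^ (j + 1))) (fun q : ℝ × ℝ =>
        ((q.1 ^ j * Real.exp (-(q.1 ^ 4 / 4)) : ℝ) : ℂ) *
          ((q.2 ^ k * Real.exp (-(q.2 ^ 4 / 4)) : ℝ) : ℂ)),
    integral_prod_mul (fun x : ℝ => ((x ^ j * Real.exp (-(x ^ 4 / 4)) : ℝ) : ℂ))
      (fun x : ℝ => ((x ^ k * Real.exp (-(x ^ 4 / 4)) : ℝ) : ℂ)),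
    integral_count, ← Finset.mul_sum, integral_complex_ofReal, integral_complex_ofReal]

theorem contourMoment_eq_zero_of_even {j : ℕ} (hj : Even j) (k : ℕ) : contourMoment j k = 0 := by
  have hrays : ∑ i, raySign i * rayDir i ^ (j + 1) = 0 := by
    simp [Fin.sum_univ_four, raySign, rayDir, hj.add_one.neg_pow]
  rw [contourMoment_eq, hrays, mul_zero, zero_mul]

theorem contourMoment_three (k : ℕ) : contourMoment 3 k = 0 := by
  have hrays : ∑ i, raySign i * rayDir i ^ (3 + 1) = 0 := by
    simp [rayDir_pow_four, Fin.sum_univ_four, raySign]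
  rw [contourMoment_eq, hrays, mul_zero, zero_mul]

theorem contourMoment_eq_zero_of_odd (j : ℕ) {k : ℕ} (hk : Odd k) : contourMoment j k = 0 := by
  have hodd := integral_neg_eq_self (fun u : ℝ => u ^ k * Real.exp (-(u ^ 4 / 4))) volume
  simp only [hk.neg_pow, neg_mul, integral_neg, (by decide : Even 4).neg_pow] at hodd
  rw [contourMoment_eq, self_eq_neg.1 hodd.symm, Complex.ofReal_zero, mul_zero, mul_zero]

theorem contourMoment_one_two_pos : 0 < (contourMoment 1 2).re := by
  have hrays : ∑ i, raySign i * rayDir i ^ (1 + 1) = -4 * Complex.I := by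
    simp only [Fin.sum_univ_four, raySign, rayDir, Matrix.cons_val, Nat.reduceAdd, neg_sq,
      pearceyOmega_sq, conj_pearceyOmega_sq]
    ring
  have heven : ∫ u : ℝ, u ^ 2 * Real.exp (-(u ^ 4 / 4)) =
      2 * ∫ ρ in Set.Ioi (0 : ℝ), ρ ^ 2 * Real.exp (-(ρ ^ 4 / 4)) := by
    rw [← integral_comp_abs]
    simp only [sq_abs, (by decide : Even 4).pow_abs]
  have hpos₁ := integral_pow_mul_exp_quartic_pos 1
  have hpos₂ := integral_pow_mul_exp_quartic_pos 2
  rw [contourMoment_eq, hrays, heven]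
  set a := ∫ ρ in Set.Ioi (0 : ℝ), ρ ^ 1 * Real.exp (-(ρ ^ 4 / 4))
  set b := ∫ ρ in Set.Ioi (0 : ℝ), ρ ^ 2 * Real.exp (-(ρ ^ 4 / 4))
  have hvalue : -(1 / (4 * (Real.pi : ℂ) ^ 2)) * Complex.I ^ (2 + 1) * (-4 * Complex.I) *
      ((a : ℂ) * ((2 * b : ℝ) : ℂ)) = ((2 * a * b / Real.pi ^ 2 : ℝ) : ℂ) := by
    push_cast
    linear_combination (2 * a * b / (Real.pi : ℂ) ^ 2) * Complex.I_pow_four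
  rw [hvalue, Complex.ofReal_re]
  positivity

theorem integral_baseWeight_mul_sum {n : ℕ} (c : Fin (n + 1) → ℂ) :
    ∫ p, baseWeight p * ∑ i, c i * (pointV p ^ (i : ℕ) * pointU p ^ (n - (i : ℕ))) ∂contourMeasure =
      ∑ i, c i * contourMoment i (n - (i : ℕ)) := by
  simp only [Finset.mul_sum, mul_left_comm _ (c _)]
  rw [integral_finsetSum _ fun (i : Fin (n + 1)) _ =>
    (integrable_baseWeight_mul (i : ℕ) (n - (i : ℕ))).const_mul (c i)]
  simp only [integral_const_mul, contourMoment]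

theorem integral_baseWeight_mul_quadratic (c : Fin 3 → ℂ) :
    ∫ p, baseWeight p * ∑ i, c i * (pointV p ^ (i : ℕ) * pointU p ^ (2 - (i : ℕ))) ∂contourMeasure =
      0 := by
  rw [integral_baseWeight_mul_sum]
  simp [Fin.sum_univ_three, contourMoment_eq_zero_of_even, contourMoment_eq_zero_of_odd]

theorem integral_baseWeight_mul_cubic (c : Fin 4 → ℂ) :
    ∫ p, baseWeight p * ∑ i, c i * (pointV p ^ (i : ℕ) * pointU p ^ (3 - (i : ℕ))) ∂contourMeasure =
      c 1 * contourMoment 1 2 := by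
  rw [integral_baseWeight_mul_sum]
  simp [Fin.sum_univ_four, contourMoment_eq_zero_of_even, contourMoment_three]

end Moments

section Density

theorem contourWeight_mul_sub {p : ContourParam} (hρ : 0 < p.2.1) (hu : p.2.2 ≠ 0) :
    contourWeight p * (pointU p - pointV p) = baseWeight p := by
  rw [contourWeight, mul_assoc, one_div_mul_cancel (sub_ne_zero.2 (pointU_ne_pointV hρ hu)),
    mul_one]

/-- The density `K_{t,t}(h,h)` of the Pearcey process as a function of `(t,h)`. -/
noncomputable def pearceyDensity (z : ℝ × ℝ) : ℝ := pearceyKernel z.1 z.1 z.2 z.2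

/-- The map `(t,h) ↦ (t,h,h)`. -/
noncomputable def densityEmbedding : ℝ × ℝ →L[ℝ] ℂ × ℂ × ℂ :=
  (Complex.ofRealCLM.comp (ContinuousLinearMap.fst ℝ ℝ ℝ)).prod
    ((Complex.ofRealCLM.comp (ContinuousLinearMap.snd ℝ ℝ ℝ)).prod
      (Complex.ofRealCLM.comp (ContinuousLinearMap.snd ℝ ℝ ℝ)))

theorem pearceyDensity_eq_comp :
    pearceyDensity = Complex.reCLM ∘ contourTransform ∘ densityEmbedding := by
  funext z
  rw [pearceyDensity, pearceyKernel_self, ← contourTransform_eq_pearceyContour]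
  rfl

theorem contDiff_pearceyDensity : ContDiff ℝ ω pearceyDensity := by
  rw [pearceyDensity_eq_comp]
  exact Complex.reCLM.contDiff.comp (contDiff_contourTransform.comp densityEmbedding.contDiff)

theorem iteratedFDeriv_pearceyDensity_zero {n : ℕ} (v : Fin n → ℝ × ℝ) :
    iteratedFDeriv ℝ n pearceyDensity 0 v = (∫ p, contourWeight p *
      ∏ i, (exponentT p * (v i).1 + (pointV p - pointU p) * (v i).2) ∂contourMeasure).re := by
  have hcomp : ContDiff ℝ ω ((contourTransform (𝔸 := ℂ)) ∘ densityEmbedding) :=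
    contDiff_contourTransform.comp densityEmbedding.contDiff
  have hexponent (p : ContourParam) (w : ℝ × ℝ) : contourExponent ℂ p (densityEmbedding w) =
      exponentT p * w.1 + (pointV p - pointU p) * w.2 := by
    rw [contourExponent_apply, sub_mul, ← add_sub_assoc]
    rfl
  rw [pearceyDensity_eq_comp,
    Complex.reCLM.iteratedFDeriv_comp_left hcomp.contDiffAt (i := n) (by exact le_top),
    densityEmbedding.iteratedFDeriv_comp_right contDiff_contourTransform _ (by exact le_top),
    ContinuousLinearMap.compContinuousMultilinearMap_coe, Function.comp_apply,
    ContinuousMultilinearMap.compContinuousLinearMap_apply, map_zero,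
    iteratedFDeriv_contourTransform_zero]
  simp only [hexponent, Algebra.algebraMap_self, RingHom.id_apply, Complex.reCLM_apply]

theorem iteratedFDeriv_pearceyDensity_space_three :
    iteratedFDeriv ℝ 3 pearceyDensity 0 ![(0, 1), (0, 1), (0, 1)] = 0 := by
  rw [iteratedFDeriv_pearceyDensity_zero]
  trans (0 : ℂ).re
  · rw [← integral_baseWeight_mul_quadratic ![-1, 2, -1]]
    refine congrArg Complex.re (integral_congr_ae ?_)
    filter_upwards [ae_contourMeasure] with p ⟨hρ, hu⟩
    simp only [Fin.prod_univ_three, Fin.sum_univ_three, Matrix.cons_val, Fin.coe_ofNat_eq_mod,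
      Nat.reduceMod, Nat.reduceSub, Complex.ofReal_zero, Complex.ofReal_one,
      ← contourWeight_mul_sub hρ hu]
    ring
  · exact Complex.zero_re

theorem iteratedFDeriv_pearceyDensity_space_four :
    iteratedFDeriv ℝ 4 pearceyDensity 0 ![(0, 1), (0, 1), (0, 1), (0, 1)] =
      -3 * (contourMoment 1 2).re := by
  rw [iteratedFDeriv_pearceyDensity_zero]
  trans (![1, -3, 3, -1] 1 * contourMoment 1 2).re
  · rw [← integral_baseWeight_mul_cubic]
    refine congrArg Complex.re (integral_congr_ae ?_)
    filter_upwards [ae_contourMeasure] with p ⟨hρ, hu⟩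
    simp only [Fin.prod_univ_four, Fin.sum_univ_four, Matrix.cons_val, Fin.coe_ofNat_eq_mod,
      Nat.reduceMod, Nat.reduceSub, Complex.ofReal_zero, Complex.ofReal_one,
      ← contourWeight_mul_sub hρ hu]
    ring
  · simp

theorem iteratedFDeriv_pearceyDensity_time_space_two :
    iteratedFDeriv ℝ 3 pearceyDensity 0 ![(1, 0), (0, 1), (0, 1)] =
      -(1 / 2) * (contourMoment 1 2).re := by
  rw [iteratedFDeriv_pearceyDensity_zero]
  trans (![1 / 2, -(1 / 2), -(1 / 2), 1 / 2] 1 * contourMoment 1 2).re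
  · rw [← integral_baseWeight_mul_cubic]
    refine congrArg Complex.re (integral_congr_ae ?_)
    filter_upwards [ae_contourMeasure] with p ⟨hρ, hu⟩
    simp only [Fin.prod_univ_three, Fin.sum_univ_four, Matrix.cons_val, Fin.coe_ofNat_eq_mod,
      Nat.reduceMod, Nat.reduceSub, Complex.ofReal_zero, Complex.ofReal_one,
      ← contourWeight_mul_sub hρ hu, exponentT]
    ring
  · simp

end Density

section TangentialDerivatives

variable {𝕜 E F G : Type*} [NontriviallyNormedField 𝕜] [NormedAddCommGroup E] [NormedSpace 𝕜 E]
  [NormedAddCommGroup F] [NormedSpace 𝕜 F] [NormedAddCommGroup G] [NormedSpace 𝕜 G]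

theorem iteratedFDeriv_comp_continuousLinearMap {f : E → F} {n : ℕ} (ι : G →L[𝕜] E) {x : G}
    (hf : ContDiffAt 𝕜 n f (ι x)) :
    iteratedFDeriv 𝕜 n (f ∘ ι) x =
      (iteratedFDeriv 𝕜 n f (ι x)).compContinuousLinearMap fun _ => ι := by
  obtain ⟨U, hU, hxU, hfU⟩ := hf.contDiffOn' le_rfl (by simp)
  rw [Set.insert_eq_of_mem (Set.mem_univ _), Set.univ_inter] at hfU
  have hU' : IsOpen (ι ⁻¹' U) := hU.preimage ι.continuous
  rw [← iteratedFDerivWithin_of_isOpen n hU hxU, ← iteratedFDerivWithin_of_isOpen n hU' hxU]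
  exact ι.iteratedFDerivWithin_comp_right hfU hU.uniqueDiffOn hU'.uniqueDiffOn hxU le_rfl

theorem iteratedFDeriv_succ_cons {f : E → F} {x : E} (hf : ContDiffAt 𝕜 ω f x) {n : ℕ} (a : E)
    (v : Fin n → E) :
    iteratedFDeriv 𝕜 (n + 1) f x (Fin.cons a v) =
      iteratedFDeriv 𝕜 n (fun y => fderiv 𝕜 f y a) x v := by
  have hf' : ContDiffAt 𝕜 n (fderiv 𝕜 f) x := (hf.fderiv_right (m := ω) le_rfl).of_le le_top
  calc iteratedFDeriv 𝕜 (n + 1) f x (Fin.cons a v)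
      = iteratedFDeriv 𝕜 (n + 1) f x (Fin.snoc v a) := by
        rw [Fin.snoc_eq_cons_rotate]
        exact (hf.iteratedFDeriv_comp_perm (Fin.cons a v) (finRotate (n + 1))).symm
    _ = iteratedFDeriv 𝕜 n (fderiv 𝕜 f) x v a := by
        rw [iteratedFDeriv_succ_apply_right, Fin.init_snoc, Fin.snoc_last]
    _ = iteratedFDeriv 𝕜 n (fun y => fderiv 𝕜 f y a) x v := by
        have h := (ContinuousLinearMap.apply 𝕜 F a).iteratedFDeriv_comp_left hf' le_rfl
        exact (DFunLike.congr_fun h v).symm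

theorem iteratedFDeriv_apply_comp_eq_zero {f : E → F} {n : ℕ} (ι : G →L[𝕜] E) {x : G}
    (hf : ContDiffAt 𝕜 n f (ι x)) (hι : f ∘ ι =ᶠ[nhds x] fun _ => 0) (v : Fin n → G) :
    iteratedFDeriv 𝕜 n f (ι x) (ι ∘ v) = 0 := by
  have h := congrArg (· v) (iteratedFDeriv_comp_continuousLinearMap ι hf)
  rw [(hι.iteratedFDeriv 𝕜 n).eq_of_nhds, iteratedFDeriv_fun_zero] at h
  exact h.symm

theorem hasDerivAt_iteratedFDeriv_apply_comp {f : E → F} (ι : G →L[𝕜] E) {x : G}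
    (hf : ContDiffAt 𝕜 ω f (ι x)) (a : E) {n : ℕ} (v : Fin n → G) :
    HasDerivAt (fun ε : 𝕜 => iteratedFDeriv 𝕜 n f (ι x + ε • a) (ι ∘ v))
      (iteratedFDeriv 𝕜 n (fun y => fderiv 𝕜 f (ι y) a) x v) 0 := by
  have hd : DifferentiableAt 𝕜 (iteratedFDeriv 𝕜 n f) (ι x) :=
    hf.differentiableAt_iteratedFDeriv (WithTop.coe_lt_top _)
  have ha : ContDiffAt 𝕜 n (fun y => fderiv 𝕜 f y a) (ι x) :=
    ((hf.fderiv_right (m := ω) le_rfl).clm_apply contDiffAt_const).of_le le_top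
  have hvalue : iteratedFDeriv 𝕜 n (fun y => fderiv 𝕜 f (ι y) a) x v =
      fderiv 𝕜 (iteratedFDeriv 𝕜 n f) (ι x) a (ι ∘ v) := by
    calc iteratedFDeriv 𝕜 n (fun y => fderiv 𝕜 f (ι y) a) x v
        = iteratedFDeriv 𝕜 n (fun y => fderiv 𝕜 f y a) (ι x) (ι ∘ v) :=
          congrArg (· v) (iteratedFDeriv_comp_continuousLinearMap ι ha)
      _ = iteratedFDeriv 𝕜 (n + 1) f (ι x) (Fin.cons a (ι ∘ v)) :=
          (iteratedFDeriv_succ_cons hf a _).symm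
      _ = fderiv 𝕜 (iteratedFDeriv 𝕜 n f) (ι x) a (ι ∘ v) := by
          rw [iteratedFDeriv_succ_apply_left, Fin.cons_zero, Fin.tail_cons]
  have hline : HasDerivAt (fun ε : 𝕜 => ι x + ε • a) a 0 := by
    simpa using ((hasDerivAt_id (0 : 𝕜)).smul_const a).const_add (ι x)
  rw [hvalue]
  have hd' : HasFDerivAt (iteratedFDeriv 𝕜 n f) (fderiv 𝕜 (iteratedFDeriv 𝕜 n f) (ι x))
      (ι x + (0 : 𝕜) • a) := by
    simpa using hd.hasFDerivAt
  exact (ContinuousMultilinearMap.apply 𝕜 (fun _ => E) F (ι ∘ v)).hasFDerivAt.comp_hasDerivAt 0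
    (hd'.comp_hasDerivAt 0 hline)

end TangentialDerivatives

section BoundaryOperators

open Topology

variable {m : ℕ}

theorem boundaryDeriv_eq_fderiv {f : ℝ → (Fin m → ℝ) → ℝ} {z : ℝ × (Fin m → ℝ)}
    (hf : DifferentiableAt ℝ (Function.uncurry f) z) :
    boundaryDeriv f z.1 z.2 = fderiv ℝ (Function.uncurry f) z (0, 1) := by
  have hpartial (i : Fin m) : deriv (fun s => f z.1 (Function.update z.2 i s)) (z.2 i) =
      fderiv ℝ (Function.uncurry f) z (0, Pi.single i 1) := by
    have hline : HasDerivAt (fun s => (z.1, Function.update z.2 i s)) (0, Pi.single i 1) (z.2 i) :=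
      (hasDerivAt_const _ _).prodMk (hasDerivAt_update z.2 i (z.2 i))
    have hf' : HasFDerivAt (Function.uncurry f) (fderiv ℝ (Function.uncurry f) z)
        (z.1, Function.update z.2 i (z.2 i)) := by
      simpa using hf.hasFDerivAt
    exact (hf'.comp_hasDerivAt (z.2 i) hline).deriv
  have hsum : ∑ i, ((0 : ℝ), (Pi.single i 1 : Fin m → ℝ)) = (0, 1) :=
    Prod.ext (by simp [Prod.fst_sum])
      (by rw [Prod.snd_sum]; exact Finset.univ_sum_single (1 : Fin m → ℝ))
  rw [boundaryDeriv, Finset.sum_congr rfl fun i _ => hpartial i, ← map_sum, hsum]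

theorem timeDeriv_eq_fderiv {f : ℝ → (Fin m → ℝ) → ℝ} {z : ℝ × (Fin m → ℝ)}
    (hf : DifferentiableAt ℝ (Function.uncurry f) z) :
    timeDeriv f z.1 z.2 = fderiv ℝ (Function.uncurry f) z (1, 0) :=
  (HasFDerivAt.comp_hasDerivAt (l := Function.uncurry f) z.1 hf.hasFDerivAt
    ((hasDerivAt_id z.1).prodMk (hasDerivAt_const z.1 z.2))).deriv

variable {f : ℝ → (Fin m → ℝ) → ℝ} {g : ℝ × (Fin m → ℝ) → ℝ} {z : ℝ × (Fin m → ℝ)} {n : ℕ}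
  {v : Fin n → ℝ × (Fin m → ℝ)}

theorem eventually_fderiv_eq_iteratedFDeriv_succ (hg : ContDiffAt ℝ ω g z)
    (h : Function.uncurry f =ᶠ[𝓝 z] fun w => iteratedFDeriv ℝ n g w v)
    (a : ℝ × (Fin m → ℝ)) :
    ∀ᶠ w in 𝓝 z, DifferentiableAt ℝ (Function.uncurry f) w ∧
      fderiv ℝ (Function.uncurry f) w a = iteratedFDeriv ℝ (n + 1) g w (Matrix.vecCons a v) := by
  filter_upwards [hg.eventually (by simp), h.eventuallyEq_nhds] with w hgw hw
  have hd := hgw.differentiableAt_iteratedFDeriv (m := n) (WithTop.coe_lt_top _)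
  exact ⟨(hd.continuousMultilinear_apply_const v).congr_of_eventuallyEq hw,
    by rw [hw.fderiv_eq, hd.iteratedFDeriv_succ_apply_left']; rfl⟩

theorem uncurry_boundaryDeriv_eventuallyEq (hg : ContDiffAt ℝ ω g z)
    (h : Function.uncurry f =ᶠ[𝓝 z] fun w => iteratedFDeriv ℝ n g w v) :
    Function.uncurry (boundaryDeriv f) =ᶠ[𝓝 z]
      fun w => iteratedFDeriv ℝ (n + 1) g w (Matrix.vecCons (0, 1) v) := by
  filter_upwards [eventually_fderiv_eq_iteratedFDeriv_succ hg h (0, 1)] with w ⟨hd, hw⟩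
  exact (boundaryDeriv_eq_fderiv hd).trans hw

theorem uncurry_timeDeriv_eventuallyEq (hg : ContDiffAt ℝ ω g z)
    (h : Function.uncurry f =ᶠ[𝓝 z] fun w => iteratedFDeriv ℝ n g w v) :
    Function.uncurry (timeDeriv f) =ᶠ[𝓝 z]
      fun w => iteratedFDeriv ℝ (n + 1) g w (Matrix.vecCons (1, 0) v) := by
  filter_upwards [eventually_fderiv_eq_iteratedFDeriv_succ hg h (1, 0)] with w ⟨hd, hw⟩
  exact (timeDeriv_eq_fderiv hd).trans hw

theorem boundaryWronskian_eq_iteratedFDeriv (hg : ContDiffAt ℝ ω g z)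
    (h : Function.uncurry f =ᶠ[𝓝 z] g) :
    boundaryWronskian (timeDeriv (boundaryDeriv^[2] f)) (boundaryDeriv^[3] f) z.1 z.2 =
      iteratedFDeriv ℝ 3 g z ![(0, 1), (0, 1), (0, 1)] *
          iteratedFDeriv ℝ 4 g z ![(0, 1), (1, 0), (0, 1), (0, 1)] -
        iteratedFDeriv ℝ 3 g z ![(1, 0), (0, 1), (0, 1)] *
          iteratedFDeriv ℝ 4 g z ![(0, 1), (0, 1), (0, 1), (0, 1)] := by
  have h₀ : Function.uncurry f =ᶠ[𝓝 z] fun w => iteratedFDeriv ℝ 0 g w ![] := h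
  have h₂ := uncurry_boundaryDeriv_eventuallyEq hg (uncurry_boundaryDeriv_eventuallyEq hg h₀)
  have h₃ := uncurry_boundaryDeriv_eventuallyEq hg h₂
  have ht := uncurry_timeDeriv_eventuallyEq hg h₂
  exact congrArg₂ (· - ·)
    (congrArg₂ (· * ·) h₃.eq_of_nhds (uncurry_boundaryDeriv_eventuallyEq hg ht).eq_of_nhds)
    (congrArg₂ (· * ·) ht.eq_of_nhds (uncurry_boundaryDeriv_eventuallyEq hg h₃).eq_of_nhds)

end BoundaryOperators

section ChangeOfVariables

theorem pi_withDensity_ofReal {X : Type*} [MeasurableSpace X] (μ : Measure X) [IsFiniteMeasure μ]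
    {w : X → ℝ} (hw : Integrable w μ) (hw₀ : ∀ x, 0 ≤ w x) (n : ℕ) :
    Measure.pi (fun _ : Fin n => μ.withDensity fun x => ENNReal.ofReal (w x)) =
      (Measure.pi fun _ : Fin n => μ).withDensity fun x => ENNReal.ofReal (∏ i, w (x i)) := by
  have : IsFiniteMeasure (μ.withDensity fun x => ENNReal.ofReal (w x)) :=
    isFiniteMeasure_withDensity_ofReal hw.2
  refine Measure.pi_eq fun s hs => ?_
  rw [withDensity_apply _ (MeasurableSet.univ_pi hs), Measure.restrict_pi_pi,
    ← ofReal_integral_eq_lintegral_ofReal, integral_fintype_prod_eq_prod (fun _ => w),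
    ENNReal.ofReal_prod_of_nonneg]
  · refine Finset.prod_congr rfl fun i _ => ?_
    rw [withDensity_apply _ (hs i),
      ofReal_integral_eq_lintegral_ofReal hw.restrict (ae_of_all _ hw₀)]
  · exact fun i _ => integral_nonneg hw₀
  · exact Integrable.fintype_prod (f := fun _ => w) fun i => hw.restrict
  · exact ae_of_all _ fun x => Finset.prod_nonneg fun _ _ => hw₀ _

theorem fredholmDet_eq_kernelFredholmDet {X : Type*} [TopologicalSpace X] [CompactSpace X]
    [MeasurableSpace X] [BorelSpace X] (ν : Measure X) [IsFiniteMeasure ν] {φ w : X → ℝ}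
    (hφ : Continuous φ) (hw : Continuous w) (hw₀ : ∀ q, 0 ≤ w q) {E : Set ℝ}
    (hE : (ν.withDensity fun q => ENNReal.ofReal (w q)).map φ = volume.restrict E)
    {K : ℝ → ℝ → ℝ} (hK : Continuous (Function.uncurry K)) {k : C(X × X, ℝ)}
    (hk : ∀ q q', k (q, q') = w q * K (φ q) (φ q')) :
    fredholmDet K E = kernelFredholmDet ν k := by
  have hwν : Integrable w ν := hw.integrable_of_hasCompactSupport (.of_compactSpace w)
  have : IsFiniteMeasure (ν.withDensity fun q => ENNReal.ofReal (w q)) :=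
    isFiniteMeasure_withDensity_ofReal hwν.2
  have hdet (n : ℕ) : Continuous fun x : Fin n → ℝ => (Matrix.of fun i j => K (x i) (x j)).det :=
    Continuous.matrix_det <| continuous_matrix fun i j =>
      hK.comp (f := fun x : Fin n → ℝ => (x i, x j)) (by fun_prop)
  have hφn (n : ℕ) : Measurable fun (x : Fin n → X) i => φ (x i) :=
    measurable_pi_lambda _ fun i => hφ.measurable.comp (measurable_pi_apply i)
  have hwn (n : ℕ) : Measurable fun x : Fin n → X => ENNReal.ofReal (∏ i, w (x i)) := by
    have := hw.measurable
    fun_prop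
  refine tsum_congr fun n => congrArg _ ?_
  rw [volume_pi, Measure.restrict_pi_pi, ← hE,
    ← Measure.pi_map_pi (f := fun _ : Fin n => φ) fun _ => hφ.measurable.aemeasurable,
    integral_map (hφn n).aemeasurable (hdet n).aestronglyMeasurable,
    pi_withDensity_ofReal _ hwν hw₀, integral_withDensity_eq_integral_toReal_smul (hwn n)
      (ae_of_all _ fun x => ENNReal.ofReal_lt_top)]
  refine integral_congr_ae (ae_of_all _ fun x => ?_)
  simp only [hk, ENNReal.toReal_ofReal (Finset.prod_nonneg fun _ _ => hw₀ _), smul_eq_mul]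
  exact (Matrix.det_mul_column (fun i => w (x i))
    (Matrix.of fun i j => K (φ (x i)) (φ (x j)))).symm

theorem ofReal_mul_volume_affine_preimage {a b : ℝ} (hab : a < b) (s : Set ℝ) :
    ENNReal.ofReal (b - a) * volume {u : unitInterval | a + u * (b - a) ∈ s} =
      volume (s ∩ Set.Ioo a b) := by
  have hw : 0 < b - a := sub_pos.2 hab
  have himage : (Subtype.val '' {u : unitInterval | a + u * (b - a) ∈ s} : Set ℝ) =
      (fun u => (b - a) * u) ⁻¹' ((fun x => a + x) ⁻¹' (s ∩ Set.Icc a b)) := by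
    ext u
    have hlower : a ≤ a + (b - a) * u ↔ 0 ≤ u := by
      rw [le_add_iff_nonneg_right, mul_nonneg_iff_of_pos_left hw]
    have hupper : a + (b - a) * u ≤ b ↔ u ≤ 1 := by
      rw [← le_sub_iff_add_le', mul_le_iff_le_one_right hw]
    simp only [Set.mem_image, Set.mem_ofPred_eq, Set.mem_preimage, Set.mem_inter_iff, Set.mem_Icc,
      Subtype.exists, exists_and_right, exists_eq_right, mul_comm u, hlower, hupper]
    exact exists_prop.trans and_comm
  rw [unitInterval.volume_apply, himage, Real.volume_preimage_mul_left hw.ne',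
    measure_preimage_add, ← mul_assoc, ← ENNReal.ofReal_mul hw.le, abs_of_pos (inv_pos.2 hw),
    mul_inv_cancel₀ hw.ne', ENNReal.ofReal_one, one_mul]
  exact measure_congr ((Filter.EventuallyEq.refl _ s).inter Ioo_ae_eq_Icc.symm)

/-- The space parametrizing a union of `r` intervals: an interval and a relative position in it.
It does not depend on the endpoints. -/
abbrev IntervalParam (r : ℕ) : Type := Fin r × unitInterval

/-- Counting measure on the intervals times Lebesgue measure on the relative positions. -/
noncomputable def paramMeasure (r : ℕ) : Measure (IntervalParam r) :=
  Measure.count.prod volume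

instance (r : ℕ) : IsFiniteMeasure (paramMeasure r) := by
  unfold paramMeasure
  infer_instance

theorem paramMeasure_real_univ (r : ℕ) : (paramMeasure r).real Set.univ = r := by
  rw [Measure.real, paramMeasure, ← Set.univ_prod_univ, Measure.prod_prod]
  simp

variable {r : ℕ}

/-- The left endpoint of the `i`-th interval. -/
def leftEnd (y : Fin (2 * r) → ℝ) (i : Fin r) : ℝ := y ⟨2 * i.val, by omega⟩

/-- The right endpoint of the `i`-th interval. -/
def rightEnd (y : Fin (2 * r) → ℝ) (i : Fin r) : ℝ := y ⟨2 * i.val + 1, by omega⟩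

/-- The length of the interval on which a parameter lies, the Jacobian of `paramPoint`. -/
def paramWidth (y : Fin (2 * r) → ℝ) (q : IntervalParam r) : ℝ := rightEnd y q.1 - leftEnd y q.1

/-- The affine parametrization of the intervals. -/
def paramPoint (y : Fin (2 * r) → ℝ) (q : IntervalParam r) : ℝ :=
  leftEnd y q.1 + q.2 * paramWidth y q

theorem continuous_paramWidth (y : Fin (2 * r) → ℝ) : Continuous (paramWidth y) :=
  (continuous_of_discreteTopology (f := fun i => rightEnd y i - leftEnd y i)).comp continuous_fst

theorem continuous_paramPoint (y : Fin (2 * r) → ℝ) : Continuous (paramPoint y) :=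
  ((continuous_of_discreteTopology (f := leftEnd y)).comp continuous_fst).add
    ((continuous_subtype_val.comp continuous_snd).mul (continuous_paramWidth y))

variable {y : Fin (2 * r) → ℝ}

theorem leftEnd_lt_rightEnd (hy : StrictMono y) (i : Fin r) : leftEnd y i < rightEnd y i :=
  hy (by simp [Fin.lt_def])

theorem paramWidth_pos (hy : StrictMono y) (q : IntervalParam r) : 0 < paramWidth y q :=
  sub_pos.2 (leftEnd_lt_rightEnd hy q.1)

theorem pairwise_disjoint_intervals (hy : StrictMono y) :
    Pairwise (Function.onFun Disjoint fun i => Set.Ioo (leftEnd y i) (rightEnd y i)) := by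
  refine (pairwise_disjoint_on _).2 fun i j hij => Set.disjoint_left.2 fun x hi hj => ?_
  have hends : rightEnd y i < leftEnd y j :=
    hy (Fin.mk_lt_mk.2 (by rw [Fin.lt_def] at hij; omega))
  exact (hi.2.trans (hends.trans hj.1)).false

theorem map_paramPoint (hy : StrictMono y) :
    ((paramMeasure r).withDensity fun q => ENNReal.ofReal (paramWidth y q)).map (paramPoint y) =
      volume.restrict (intervalUnion y) := by
  ext s hs
  have hm : MeasurableSet (paramPoint y ⁻¹' s) := (continuous_paramPoint y).measurable hs
  have hw : Measurable fun q => ENNReal.ofReal (paramWidth y q) :=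
    (continuous_paramWidth y).measurable.ennreal_ofReal
  calc ((paramMeasure r).withDensity fun q => ENNReal.ofReal (paramWidth y q)).map
        (paramPoint y) s
      = ∫⁻ q, (paramPoint y ⁻¹' s).indicator (fun q => ENNReal.ofReal (paramWidth y q)) q
          ∂paramMeasure r := by
        rw [Measure.map_apply (continuous_paramPoint y).measurable hs, withDensity_apply _ hm,
          lintegral_indicator hm]
    _ = ∑ i, ∫⁻ u, (paramPoint y ⁻¹' s).indicator
          (fun q => ENNReal.ofReal (paramWidth y q)) (i, u) := by
        rw [paramMeasure, lintegral_prod _ (hw.indicator hm).aemeasurable, lintegral_count,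
          tsum_fintype]
    _ = ∑ i, volume (s ∩ Set.Ioo (leftEnd y i) (rightEnd y i)) := by
        refine Finset.sum_congr rfl fun i _ => ?_
        rw [← ofReal_mul_volume_affine_preimage (leftEnd_lt_rightEnd hy i) s]
        exact lintegral_indicator_const (μ := (volume : Measure unitInterval))
          (measurable_prodMk_left (x := i) hm) (ENNReal.ofReal (rightEnd y i - leftEnd y i))
    _ = volume.restrict (intervalUnion y) s := by
        have hunion : s ∩ intervalUnion y = ⋃ i, s ∩ Set.Ioo (leftEnd y i) (rightEnd y i) :=
          Set.inter_iUnion _ _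
        rw [Measure.restrict_apply hs, hunion, measure_iUnion
          (fun i j hij => (pairwise_disjoint_intervals hy hij).mono Set.inter_subset_right
            Set.inter_subset_right) fun i => hs.inter measurableSet_Ioo, tsum_fintype]

end ChangeOfVariables

section IntervalKernel

/-- The continuous linear map given by a family of continuous functions that depends linearly on a
finite-dimensional parameter. -/
noncomputable def linearFamily {V Y : Type*} [NormedAddCommGroup V] [NormedSpace ℝ V]
    [FiniteDimensional ℝ V] [TopologicalSpace Y] (F : V → C(Y, ℝ))
    (hF : ∀ q, IsLinearMap ℝ fun v => F v q) : V →L[ℝ] C(Y, ℝ) :=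
  LinearMap.toContinuousLinearMap
    { toFun := F
      map_add' := fun v v' => ContinuousMap.ext fun q => (hF q).map_add v v'
      map_smul' := fun c v => ContinuousMap.ext fun q => (hF q).map_smul c v }

variable {r : ℕ}

theorem isLinearMap_paramWidth (q : IntervalParam r) :
    IsLinearMap ℝ fun z : ℝ × (Fin (2 * r) → ℝ) => paramWidth z.2 q where
  map_add z z' := by
    simp only [paramWidth, leftEnd, rightEnd, Prod.snd_add, Pi.add_apply]
    ring
  map_smul c z := by
    simp only [paramWidth, leftEnd, rightEnd, Prod.smul_snd, Pi.smul_apply, smul_eq_mul]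
    ring

theorem isLinearMap_paramPoint (q : IntervalParam r) :
    IsLinearMap ℝ fun z : ℝ × (Fin (2 * r) → ℝ) => paramPoint z.2 q where
  map_add z z' := by
    simp only [paramPoint, paramWidth, leftEnd, rightEnd, Prod.snd_add, Pi.add_apply]
    ring
  map_smul c z := by
    simp only [paramPoint, paramWidth, leftEnd, rightEnd, Prod.smul_snd, Pi.smul_apply,
      smul_eq_mul]
    ring

/-- The Jacobian factor `paramWidth` of the kernel, as a linear function of time and endpoints. -/
noncomputable def widthCLM (r : ℕ) :
    (ℝ × (Fin (2 * r) → ℝ)) →L[ℝ] C(IntervalParam r × IntervalParam r, ℝ) :=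
  linearFamily (fun z => ⟨fun q => paramWidth z.2 q.1,
    (continuous_paramWidth z.2).comp continuous_fst⟩) fun q => isLinearMap_paramWidth q.1

/-- The arguments `(t, x, y)` of the Pearcey kernel as functions on the parameter space, depending
linearly on time and endpoints. -/
noncomputable def kernelArguments (r : ℕ) : (ℝ × (Fin (2 * r) → ℝ)) →L[ℝ]
    C(IntervalParam r × IntervalParam r, ℂ) × C(IntervalParam r × IntervalParam r, ℂ) ×
      C(IntervalParam r × IntervalParam r, ℂ) :=
  let complexify := Complex.ofRealCLM.compLeftContinuous ℝ (IntervalParam r × IntervalParam r)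
  (complexify.comp (linearFamily (fun z => ContinuousMap.const _ z.1) fun _ =>
      (ContinuousLinearMap.fst ℝ ℝ _).isLinear)).prod
    ((complexify.comp (linearFamily (fun z => ⟨fun q => paramPoint z.2 q.1,
        (continuous_paramPoint z.2).comp continuous_fst⟩) fun q =>
          isLinearMap_paramPoint q.1)).prod
      (complexify.comp (linearFamily (fun z => ⟨fun q => paramPoint z.2 q.2,
        (continuous_paramPoint z.2).comp continuous_snd⟩) fun q =>
          isLinearMap_paramPoint q.2)))

/-- The Pearcey kernel pulled back to the parameter space, without the Jacobian factor. -/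
noncomputable def pulledKernel (r : ℕ) (z : ℝ × (Fin (2 * r) → ℝ)) :
    C(IntervalParam r × IntervalParam r, ℝ) :=
  Complex.reCLM.compLeftContinuous ℝ (IntervalParam r × IntervalParam r)
    (contourTransform (kernelArguments r z))

/-- The Pearcey kernel on the union of intervals with given endpoints, as a kernel on the
parameter space. -/
noncomputable def intervalKernel (r : ℕ) (z : ℝ × (Fin (2 * r) → ℝ)) :
    C(IntervalParam r × IntervalParam r, ℝ) :=
  widthCLM r z * pulledKernel r z

variable [Nonempty (Fin r)]

theorem contDiff_pulledKernel : ContDiff ℝ ω (pulledKernel r) :=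
  (ContinuousLinearMap.contDiff _).comp
    (contDiff_contourTransform.comp (kernelArguments r).contDiff)

theorem contDiff_intervalKernel : ContDiff ℝ ω (intervalKernel r) :=
  (widthCLM r).contDiff.mul contDiff_pulledKernel

theorem pulledKernel_apply (z : ℝ × (Fin (2 * r) → ℝ)) (q q' : IntervalParam r) :
    pulledKernel r z (q, q') = pearceyKernel z.1 z.1 (paramPoint z.2 q) (paramPoint z.2 q') := by
  let χ : C(IntervalParam r × IntervalParam r, ℂ) →A[ℂ] ℂ :=
    ⟨ContinuousMap.evalAlgHom ℂ ℂ (q, q'), continuous_eval_const (q, q')⟩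
  rw [pearceyKernel_self, ← contourTransform_eq_pearceyContour]
  exact congrArg Complex.re (map_contourTransform χ (kernelArguments r z))

theorem pearceyProb_eq_kernelFredholmDet {t : ℝ} {y : Fin (2 * r) → ℝ} (hy : StrictMono y) :
    pearceyProb t y = kernelFredholmDet (paramMeasure r) (intervalKernel r (t, y)) :=
  fredholmDet_eq_kernelFredholmDet (paramMeasure r) (continuous_paramPoint y)
    (continuous_paramWidth y) (fun q => (paramWidth_pos hy q).le) (map_paramPoint hy)
    (continuous_pearceyKernel_self t)
    fun q q' => congrArg (paramWidth y q * ·) (pulledKernel_apply (t, y) q q')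

end IntervalKernel

section LogDeterminant

variable {X : Type*} [TopologicalSpace X] [CompactSpace X] [SecondCountableTopology X]
  [MeasurableSpace X] [BorelSpace X] (ν : Measure X) [IsFiniteMeasure ν]

theorem contDiffAt_log_kernelFredholmDet_zero :
    ContDiffAt ℝ ω (fun k : C(X × X, ℝ) => Real.log (kernelFredholmDet ν k)) 0 :=
  (contDiffAt_kernelFredholmDet_zero ν).log (by simp [kernelFredholmDet_zero])

theorem fderiv_log_kernelFredholmDet_zero (k : C(X × X, ℝ)) :
    fderiv ℝ (fun k : C(X × X, ℝ) => Real.log (kernelFredholmDet ν k)) 0 k =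
      -∫ x, k (x, x) ∂ν := by
  have hd : DifferentiableAt ℝ (kernelFredholmDet (𝕜 := ℝ) ν) 0 :=
    (contDiffAt_kernelFredholmDet_zero ν).differentiableAt (by simp)
  rw [fderiv.log hd (by simp [kernelFredholmDet_zero])]
  simp [kernelFredholmDet_zero, fderiv_kernelFredholmDet_zero]

end LogDeterminant

section Expansion

open Filter Topology

theorem isOpen_strictMono {ι : Type*} [Finite ι] [Preorder ι] :
    IsOpen {y : ι → ℝ | StrictMono y} := by
  simp only [StrictMono, Set.ofPred_forall]
  exact isOpen_iInter_of_finite fun i => isOpen_iInter_of_finite fun j =>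
    isOpen_iInter_of_finite fun _ => isOpen_lt (continuous_apply i) (continuous_apply j)

theorem eventually_mul_sub_mul_ne_zero {g₁ g₂ g₃ g₄ : ℝ → ℝ} {c₁ c₂ c₃ c₄ : ℝ}
    (h₁ : HasDerivAt g₁ c₁ 0) (h₂ : HasDerivAt g₂ c₂ 0) (h₃ : HasDerivAt g₃ c₃ 0)
    (h₄ : HasDerivAt g₄ c₄ 0) (z₁ : g₁ 0 = 0) (z₂ : g₂ 0 = 0) (z₃ : g₃ 0 = 0) (z₄ : g₄ 0 = 0)
    (hc : c₁ * c₂ - c₃ * c₄ ≠ 0) : ∀ᶠ ε in 𝓝[>] 0, g₁ ε * g₂ ε - g₃ ε * g₄ ε ≠ 0 := by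
  have slope {g : ℝ → ℝ} {c : ℝ} (h : HasDerivAt g c 0) (hz : g 0 = 0) :
      Tendsto (fun ε => ε⁻¹ * g ε) (𝓝[>] 0) (𝓝 c) := by
    simpa [hz] using h.tendsto_slope_zero_right
  have hlim := ((slope h₁ z₁).mul (slope h₂ z₂)).sub ((slope h₃ z₃).mul (slope h₄ z₄))
  filter_upwards [hlim.eventually_ne hc] with ε hε h0
  exact hε (by linear_combination ε⁻¹ * ε⁻¹ * h0)

variable {r : ℕ}

/-- The logarithm of the Fredholm determinant of `intervalKernel`. It agrees with `log ℙ` where the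
endpoints increase, and unlike `log ℙ` it is analytic also at coinciding endpoints. -/
noncomputable def logExtension (r : ℕ) (z : ℝ × (Fin (2 * r) → ℝ)) : ℝ :=
  Real.log (kernelFredholmDet (paramMeasure r) (intervalKernel r z))

/-- The inclusion `(t, h) ↦ (t, (h, …, h))` of the locus where all endpoints coincide. -/
noncomputable def diagonalCLM (r : ℕ) : (ℝ × ℝ) →L[ℝ] ℝ × (Fin (2 * r) → ℝ) :=
  (ContinuousLinearMap.fst ℝ ℝ ℝ).prod
    (ContinuousLinearMap.pi fun _ => ContinuousLinearMap.snd ℝ ℝ ℝ)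

/-- The direction `(0, (0, 1, …, 2r - 1))`, along which all the intervals have equal length. -/
noncomputable def equalSpacing (r : ℕ) : ℝ × (Fin (2 * r) → ℝ) := (0, fun i => (i.val : ℝ))

theorem strictMono_smul_equalSpacing {ε : ℝ} (hε : 0 < ε) :
    StrictMono (ε • equalSpacing r).2 :=
  fun _ _ hij => mul_lt_mul_of_pos_left (Nat.cast_lt.2 hij) hε

theorem widthCLM_diagonalCLM (z : ℝ × ℝ) : widthCLM r (diagonalCLM r z) = 0 :=
  ContinuousMap.ext fun _ => sub_self z.2

theorem widthCLM_equalSpacing : widthCLM r (equalSpacing r) = 1 :=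
  ContinuousMap.ext fun q => by
    change ((2 * q.1.1.val + 1 : ℕ) : ℝ) - ((2 * q.1.1.val : ℕ) : ℝ) = 1
    push_cast
    ring

theorem intervalKernel_diagonalCLM (z : ℝ × ℝ) : intervalKernel r (diagonalCLM r z) = 0 := by
  rw [intervalKernel, widthCLM_diagonalCLM, zero_mul]

theorem logExtension_diagonalCLM (z : ℝ × ℝ) : logExtension r (diagonalCLM r z) = 0 := by
  rw [logExtension, intervalKernel_diagonalCLM, kernelFredholmDet_zero, Real.log_one]

variable [Nonempty (Fin r)]

theorem uncurry_logPearcey_eventuallyEq {z : ℝ × (Fin (2 * r) → ℝ)} (hz : StrictMono z.2) :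
    Function.uncurry (logPearcey r) =ᶠ[𝓝 z] logExtension r := by
  filter_upwards [continuous_snd.continuousAt.eventually_mem (isOpen_strictMono.mem_nhds hz)]
    with w hw
  exact congrArg Real.log (pearceyProb_eq_kernelFredholmDet hw)

theorem pulledKernel_diagonalCLM (z : ℝ × ℝ) (q : IntervalParam r) :
    pulledKernel r (diagonalCLM r z) (q, q) = pearceyDensity z := by
  have hq : paramPoint (diagonalCLM r z).2 q = z.2 := by
    simp [diagonalCLM, paramPoint, paramWidth, leftEnd, rightEnd]
  rw [pulledKernel_apply, hq, pearceyDensity]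
  rfl

theorem contDiffAt_logExtension_diagonalCLM (z : ℝ × ℝ) :
    ContDiffAt ℝ ω (logExtension r) (diagonalCLM r z) := by
  have hlog := contDiffAt_log_kernelFredholmDet_zero (paramMeasure r)
  rw [← intervalKernel_diagonalCLM z] at hlog
  exact hlog.comp (diagonalCLM r z) contDiff_intervalKernel.contDiffAt

theorem eventually_kernelFredholmDet_pos :
    ∀ᶠ z in 𝓝 0, 0 < kernelFredholmDet (paramMeasure r) (intervalKernel r z) := by
  have hzero : intervalKernel r 0 = 0 := by
    simpa using intervalKernel_diagonalCLM (r := r) 0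
  have hdet := (contDiffAt_kernelFredholmDet_zero (𝕜 := ℝ) (paramMeasure r)).continuousAt
  rw [← hzero] at hdet
  have hcont := ContinuousAt.comp hdet contDiff_intervalKernel.continuous.continuousAt
  exact hcont.eventually_const_lt (by simp [hzero, kernelFredholmDet_zero])

theorem eventually_contDiffAt_logExtension : ∀ᶠ z in 𝓝 0, ContDiffAt ℝ ω (logExtension r) z := by
  have h := contDiffAt_logExtension_diagonalCLM (r := r) 0
  rw [map_zero] at h
  exact h.eventually (by simp)

theorem fderiv_intervalKernel_diagonalCLM (z : ℝ × ℝ) :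
    fderiv ℝ (intervalKernel r) (diagonalCLM r z) (equalSpacing r) =
      pulledKernel r (diagonalCLM r z) := by
  have hp : DifferentiableAt ℝ (pulledKernel r) (diagonalCLM r z) :=
    contDiff_pulledKernel.differentiable (by simp) _
  have hmul := fderiv_fun_mul (widthCLM r).differentiableAt hp
  change fderiv ℝ (fun x => widthCLM r x * pulledKernel r x) _ _ = _
  rw [hmul]
  simp [widthCLM_diagonalCLM, widthCLM_equalSpacing]

theorem fderiv_logExtension_diagonalCLM (z : ℝ × ℝ) :
    fderiv ℝ (logExtension r) (diagonalCLM r z) (equalSpacing r) = -(r : ℝ) * pearceyDensity z := by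
  let logDet (k : C(IntervalParam r × IntervalParam r, ℝ)) : ℝ :=
    Real.log (kernelFredholmDet (paramMeasure r) k)
  have hlog : DifferentiableAt ℝ logDet (intervalKernel r (diagonalCLM r z)) := by
    rw [intervalKernel_diagonalCLM]
    exact (contDiffAt_log_kernelFredholmDet_zero _).differentiableAt (by simp)
  calc fderiv ℝ (logExtension r) (diagonalCLM r z) (equalSpacing r)
      = fderiv ℝ logDet 0 (pulledKernel r (diagonalCLM r z)) := by
        rw [← fderiv_intervalKernel_diagonalCLM, ← intervalKernel_diagonalCLM z]
        exact congrArg (· (equalSpacing r)) (fderiv_comp (diagonalCLM r z) hlog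
          (contDiff_intervalKernel.differentiable (by simp) _))
    _ = -∫ q, pulledKernel r (diagonalCLM r z) (q, q) ∂paramMeasure r :=
        fderiv_log_kernelFredholmDet_zero _ _
    _ = -(r : ℝ) * pearceyDensity z := by
        simp only [pulledKernel_diagonalCLM, integral_const, paramMeasure_real_univ, smul_eq_mul,
          neg_mul]

theorem iteratedFDeriv_logExtension_zero {n : ℕ} (v : Fin n → ℝ × ℝ) :
    iteratedFDeriv ℝ n (logExtension r) 0 (diagonalCLM r ∘ v) = 0 := by
  have h := iteratedFDeriv_apply_comp_eq_zero (diagonalCLM r)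
    ((contDiffAt_logExtension_diagonalCLM 0).of_le le_top)
    (Eventually.of_forall logExtension_diagonalCLM) v
  rwa [map_zero] at h

theorem hasDerivAt_iteratedFDeriv_logExtension {n : ℕ} (v : Fin n → ℝ × ℝ) :
    HasDerivAt
      (fun ε : ℝ => iteratedFDeriv ℝ n (logExtension r) (ε • equalSpacing r) (diagonalCLM r ∘ v))
      (-(r : ℝ) * iteratedFDeriv ℝ n pearceyDensity 0 v) 0 := by
  have h := hasDerivAt_iteratedFDeriv_apply_comp (diagonalCLM r)
    (contDiffAt_logExtension_diagonalCLM 0) (equalSpacing r) v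
  have hscale := iteratedFDeriv_const_smul_apply' (a := -(r : ℝ)) (x := (0 : ℝ × ℝ))
    (contDiff_pearceyDensity.of_le (le_top : (n : WithTop ℕ∞) ≤ ω)).contDiffAt
  simp only [smul_eq_mul] at hscale
  simpa only [map_zero, zero_add, fderiv_logExtension_diagonalCLM, hscale,
    smul_apply, smul_eq_mul] using h

theorem eventually_wronskian_logExtension_ne_zero : ∀ᶠ ε : ℝ in 𝓝[>] 0,
    iteratedFDeriv ℝ 3 (logExtension r) (ε • equalSpacing r) ![(0, 1), (0, 1), (0, 1)] *
        iteratedFDeriv ℝ 4 (logExtension r) (ε • equalSpacing r)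
          ![(0, 1), (1, 0), (0, 1), (0, 1)] -
      iteratedFDeriv ℝ 3 (logExtension r) (ε • equalSpacing r) ![(1, 0), (0, 1), (0, 1)] *
        iteratedFDeriv ℝ 4 (logExtension r) (ε • equalSpacing r)
          ![(0, 1), (0, 1), (0, 1), (0, 1)] ≠ 0 := by
  have comp_vecCons {n : ℕ} (a : ℝ × ℝ) (v : Fin n → ℝ × ℝ) :
      diagonalCLM r ∘ Matrix.vecCons a v = Matrix.vecCons (diagonalCLM r a) (diagonalCLM r ∘ v) :=
    Fin.comp_cons _ _ _
  have comp_empty : diagonalCLM r ∘ ![] = ![] := Matrix.empty_eq _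
  have hspace : ((0 : ℝ), (1 : Fin (2 * r) → ℝ)) = diagonalCLM r (0, 1) := rfl
  have htime : ((1 : ℝ), (0 : Fin (2 * r) → ℝ)) = diagonalCLM r (1, 0) := rfl
  have hzero {n : ℕ} (v : Fin n → ℝ × ℝ) :
      iteratedFDeriv ℝ n (logExtension r) ((0 : ℝ) • equalSpacing r) (diagonalCLM r ∘ v) = 0 := by
    rw [zero_smul, iteratedFDeriv_logExtension_zero]
  have hr : (0 : ℝ) < r := Nat.cast_pos.2 (Fin.pos_iff_nonempty.2 ‹_›)
  have h := eventually_mul_sub_mul_ne_zero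
    (hasDerivAt_iteratedFDeriv_logExtension (r := r) (n := 3) ![(0, 1), (0, 1), (0, 1)])
    (hasDerivAt_iteratedFDeriv_logExtension (n := 4) ![(0, 1), (1, 0), (0, 1), (0, 1)])
    (hasDerivAt_iteratedFDeriv_logExtension (n := 3) ![(1, 0), (0, 1), (0, 1)])
    (hasDerivAt_iteratedFDeriv_logExtension (n := 4) ![(0, 1), (0, 1), (0, 1), (0, 1)])
    (hzero _) (hzero _) (hzero _) (hzero _) (by
      rw [iteratedFDeriv_pearceyDensity_space_three, iteratedFDeriv_pearceyDensity_space_four,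
        iteratedFDeriv_pearceyDensity_time_space_two]
      have := mul_pos hr contourMoment_one_two_pos
      nlinarith)
  simpa only [comp_vecCons, hspace, htime, comp_empty] using h

end Expansion

/-- For every number `r ≥ 1` of intervals, the Wronskian
`{∂_t ∂_E² log ℙ, ∂_E³ log ℙ}_{∂_E}` is not the zero function: it is nonzero at some time `t` and
some boundary points `y₁ < ⋯ < y_{2r}` where `ℙ > 0` and near which `log ℙ` is four times
continuously differentiable, so that all derivatives in it are genuine. -/
theorem proposition6p1 (r : ℕ) (hr : 1 ≤ r) :
    ∃ (t : ℝ) (y : Fin (2 * r) → ℝ), StrictMono y ∧ 0 < pearceyProb t y ∧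
      ContDiffAt ℝ 4 (fun z : ℝ × (Fin (2 * r) → ℝ) => logPearcey r z.1 z.2) (t, y) ∧
      boundaryWronskian (timeDeriv (boundaryDeriv^[2] (logPearcey r)))
        (boundaryDeriv^[3] (logPearcey r)) t y ≠ 0 := by
  have : Nonempty (Fin r) := ⟨⟨0, hr⟩⟩
  have hcont : Continuous fun ε : ℝ => ε • equalSpacing r := by fun_prop
  have hline := (hcont.tendsto' 0 0 (zero_smul ℝ _)).mono_left
    (nhdsWithin_le_nhds (s := Set.Ioi 0))
  have hpos := hline.eventually (eventually_kernelFredholmDet_pos (r := r))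
  have hsmooth := hline.eventually (eventually_contDiffAt_logExtension (r := r))
  have hwronskian := eventually_wronskian_logExtension_ne_zero (r := r)
  obtain ⟨ε, hpos, hsmooth, hwronskian, hε⟩ :=
    (hpos.and (hsmooth.and (hwronskian.and self_mem_nhdsWithin))).exists
  have hmono := strictMono_smul_equalSpacing (r := r) hε
  have hlog := uncurry_logPearcey_eventuallyEq hmono
  refine ⟨(ε • equalSpacing r).1, (ε • equalSpacing r).2, hmono, ?_, ?_, ?_⟩
  · rwa [pearceyProb_eq_kernelFredholmDet hmono]
  · exact (hsmooth.of_le le_top).congr_of_eventuallyEq hlog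
  · rwa [boundaryWronskian_eq_iteratedFDeriv hsmooth hlog]
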